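/- Let $p$ be a prime and let $\mathcal F=\{F_1,\dots,F_n\}$, $n\ge 1$, be a $p$-adic iterated function system with maps $F_i:\mathbb Q_p\to\mathbb Q_p$, $F_i(x)=(-1)^{b_i}p^{k_i}x+d_i$, where $b_i\in\{0,1\}$, $k_i\ge 1$ is an integer and $d_i\in\mathbb Z_p\cap\mathbb Q$. Let $K\subseteq\mathbb Q_p$ be its attractor, i.e. the non-empty compact set with $K=\bigcup_i F_i(K)$. The points of $K$ are exactly the address sums $$x_a=\sum_{j\ge 0}(-1)^{\sum_{i<j}b_{a_i}}\,p^{\sum_{i<j}k_{a_i}}\,d_{a_j},\qquad a=(a_j)_{j\ge0}\in\{1,\dots,n\}^{\mathbb N}.$$ The standard expansion of $x\in\mathbb Z_p$ is the infinite word $w\in\{0,\dots,p-1\}^{\mathbb N}$ with $x=\sum_{i\ge0} w_ip^i$. Finite automata here have a single initial state and all their states are accepting; such an automaton accepts an infinite word if it accepts all of its finite prefixes. A $p$-adic path set fractal is a set of the form $\{\sum_i w_ip^i : w \text{ is an infinite word accepted by } \mathcal A\}$ for a finite automaton $\mathcal A$ over $\{0,\dots,p-1\}$. 1. The rewriting of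 address sums into standard expansions is realized by a finite state transducer, which has exactly one transition for each state and each input letter: reading an address $a$, it writes the standard expansion of $x_a$ (and no other infinite word). Its states are pairs $(s,\varepsilon)$ of a carry $s\in\mathbb Z_p\cap\mathbb Q$ and a sign $\varepsilon\in\{1,-1\}$, and its initial state is $(0,1)$. A transition from $(s,\varepsilon)$ to $(s',\varepsilon')$ reading $i$ writes a block $u_0\dots u_{k_i-1}$ of $k_i$ digits with $s+\varepsilon d_i=\sum_{j<k_i}u_jp^j+p^{k_i}s'$ and $\varepsilon'=(-1)^{b_i}\varepsilon$. 2. There is a deterministic finite automaton whose accepted infinite words are exactly the standard expansions of the points of $K$, and for which $\dim_{\mathrm H}K=\log\lambda/\log p$, where $\lambda$ is the spectral radius of its adjacency matrix (whose $(q,q')$ entry is the number of transitions from $q$ to $q'$). 3. The Hausdorff dimension of $K$ is computable, uniformly in the data: there is one computable function $f$ with values in $\mathbb N$ such that for every $p$, every system $\mathcal F$ as above with attractor $K$ and every $N\in\mathbb N$, $$\left|\dim_{\mathrm H}K-\frac{f\bigl(p,(b_i,k_i,d_i)_{i\le n},N\bigr)}{N+1}\right|\le\frac1{N+1},$$ where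 each $d_i$ is given to $f$ as its numerator and denominator in lowest terms. 4. $K$ is a $p$-adic path set fractal. -/

import Mathlib

/-- A `p`-adic iterated function system consisting of finitely many (at least one) maps
`x ↦ (-1) ^ b i * p ^ k i * x + d i`, with `b i ∈ {0, 1}`, `k i ≥ 1` and `d i ∈ ℤ_p ∩ ℚ`. -/
structure PadicIFS (p : ℕ) [Fact p.Prime] where
  n : ℕ
  n_pos : 0 < n
  b : Fin n → Fin 2
  k : Fin n → ℕ
  one_le_k : ∀ i, 1 ≤ k i
  d : Fin n → ℚ
  d_mem : ∀ i, ‖(d i : ℚ_[p])‖ ≤ 1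

namespace PadicIFS

variable {p : ℕ} [Fact p.Prime]

/-- The `i`-th contraction of the system. -/
noncomputable def map (F : PadicIFS p) (i : Fin F.n) (x : ℚ_[p]) : ℚ_[p] :=
  (-1) ^ (F.b i : ℕ) * (p : ℚ_[p]) ^ F.k i * x + (F.d i : ℚ_[p])

/-- `K` is the attractor (the `p`-adic self-similar set) of the system. -/
def IsAttractor (F : PadicIFS p) (K : Set ℚ_[p]) : Prop :=
  K.Nonempty ∧ IsCompact K ∧ K = ⋃ i, F.map i '' K

/-- The `j`-th term of the address sum of `a`:
`(-1) ^ (b_{a 0} + ⋯ + b_{a (j-1)}) * p ^ (k_{a 0} + ⋯ + k_{a (j-1)}) * d_{a j}`. -/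
noncomputable def addressTerm (F : PadicIFS p) (a : ℕ → Fin F.n) (j : ℕ) : ℚ_[p] :=
  (-1) ^ (∑ i ∈ Finset.range j, (F.b (a i) : ℕ)) *
    (p : ℚ_[p]) ^ (∑ i ∈ Finset.range j, F.k (a i)) * (F.d (a j) : ℚ_[p])

/-- `x` is the sum of the series attached to the address `a`. -/
def IsAddressSum (F : PadicIFS p) (a : ℕ → Fin F.n) (x : ℚ_[p]) : Prop :=
  HasSum (F.addressTerm a) x

/-- The system written as finite data: the list of the tuples `(b i, k i, num (d i), den (d i))`,
where the rational number `d i` is written in lowest terms. -/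
def code (F : PadicIFS p) : List (Fin 2 × ℕ × ℤ × ℕ) :=
  List.ofFn fun i => (F.b i, F.k i, (F.d i).num, (F.d i).den)

end PadicIFS

/-- `w 0, w 1, …` is the standard expansion `x = ∑ w i * p ^ i` of `x`. -/
def IsPadicExpansion (p : ℕ) [Fact p.Prime] (w : ℕ → Fin p) (x : ℚ_[p]) : Prop :=
  HasSum (fun i => ((w i : ℕ) : ℚ_[p]) * (p : ℚ_[p]) ^ i) x

/-- The language of the standard expansions of the points of `K`. -/
def expansionLanguage (p : ℕ) [Fact p.Prime] (K : Set ℚ_[p]) : Set (ℕ → Fin p) :=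
  {w | ∃ x ∈ K, IsPadicExpansion p w x}

/-- A transducer with input alphabet `A`, output alphabet `B` and set of states `Q`. A transition
`(q, a, q', u)` leads from `q` to `q'`, reads the letter `a` and writes the finite word `u`. -/
structure Transducer (A B Q : Type) where
  init : Q
  trans : Set (Q × A × Q × List B)

namespace Transducer

variable {A B Q : Type}

/-- In each state there is exactly one transition for each input letter. -/
def IsSequential (T : Transducer A B Q) : Prop :=
  ∀ (q : Q) (a : A), ∃! r : Q × List B, (q, a, r.1, r.2) ∈ T.trans

/-- Reading the infinite word `a`, the transducer can write the infinite word `w`: there is a run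
`q 0, q 1, …` on `a` from the initial state, with output blocks `u 0, u 1, …`, whose concatenation
is `w`. -/
def Writes (T : Transducer A B Q) (a : ℕ → A) (w : ℕ → B) : Prop :=
  ∃ (q : ℕ → Q) (u : ℕ → List B), q 0 = T.init ∧
    (∀ j, (q j, a j, q (j + 1), u j) ∈ T.trans) ∧
    (∀ m, ((List.range m).map u).flatten =
      (List.range ((List.range m).map u).flatten.length).map w) ∧
    (∀ N, ∃ m, N ≤ ((List.range m).map u).flatten.length)

end Transducer

namespace NFA

variable {A σ : Type}

/-- There is one initial state, and all states are accepting. -/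
def IsPathAutomaton (M : NFA A σ) : Prop :=
  (∃ i, M.start = {i}) ∧ M.accept = Set.univ

/-- From every state, at most one transition is labelled by a given letter. -/
def IsDeterministic (M : NFA A σ) : Prop :=
  ∀ q a, (M.step q a).Subsingleton

/-- The infinite words all of whose finite prefixes are accepted. -/
def infiniteWords (M : NFA A σ) : Set (ℕ → A) :=
  {w | ∀ m, (List.range m).map w ∈ M.accepts}

/-- The adjacency matrix: the `(q, q')` entry is the number of transitions from `q` to `q'`. -/
noncomputable def adjacency (M : NFA A σ) : Matrix σ σ ℂ :=
  fun q q' => (Set.ncard {a | q' ∈ M.step q a} : ℂ)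

end NFA

/-- `K` is a `p`-adic path set fractal: it consists of the `p`-adic numbers whose expansions are
the infinite words accepted by a finite automaton over `{0, …, p - 1}`, all of whose states are
accepting. -/
def IsPathSetFractal (p : ℕ) [Fact p.Prime] (K : Set ℚ_[p]) : Prop :=
  ∃ (σ : Type) (_ : Finite σ) (M : NFA (Fin p) σ), M.IsPathAutomaton ∧
    K = {x | ∃ w ∈ M.infiniteWords, IsPadicExpansion p w x}

/-! Everything takes place in ℤ_p. A composition of maps along a finite word l is x ↦ ±p^κ(l) x +
c_l. With D the product of the denominators of the d_i, prime to p, D c_l is an integer of absolute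
value at most E(p^κ(l) - 1), where E is a constant. Contraction and compactness identify K with the
set of address sums.

Transducer: adding ±d_i to a carry c/D and dividing by p^k_i with remainder gives a new carry c'/D.
The bound |c| ≤ E + 2D is preserved, so finitely many carries suffice. The invariant `run_invariant`
says that x_a is what has been written, followed by carry plus sign times the remaining address sum.

Automaton: its states are the non-empty residuals of K, i.e. the sets of y such that u followed by y
is in K. By `exists_piece` a residual is a union of sets c/D ± p^j K with c and j bounded
independently of u, so there are finitely many residuals. K is closed, hence a word all of whose
prefixes begin points of K expands a point of K.

Dimension: let N_m be the number of residues of K modulo p^m. The row sums of the m-th power of the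
adjacency matrix A are prefix counts of residuals, at most C N_m with C the number of possible
pieces. Thus the norm of A^m lies between N_m and C N_m, and Gelfand's formula makes N_m grow like
λ^m. Covering K by N_m balls of radius p^(-m) bounds the dimension above. For the lower bound, no
separation is assumed; instead one word of exponent between m and m + Σk_i is chosen for each
residue modulo p^m. The resulting subsystem is separated, and its attractor, contained in K, has a
Hölder map onto [0,1] (`IsSeparated.le_dimH`), so dim K ≥ log N_m / ((m + Σk_i) log p).

Algorithm: the same inequalities show that log_p N_m differs from m dim K by at most an explicit
constant, and N_m can be computed by arithmetic modulo p^m. -/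

namespace PadicIFS

variable {p : ℕ} [Fact p.Prime]

/-! ### Address sums and the attractor -/

/-- The translation part `d i`, as a `p`-adic integer. -/
noncomputable def dInt (F : PadicIFS p) (i : Fin F.n) : ℤ_[p] := ⟨(F.d i : ℚ_[p]), F.d_mem i⟩

/-- The `i`-th contraction on `p`-adic integers. -/
noncomputable def mapInt (F : PadicIFS p) (i : Fin F.n) (x : ℤ_[p]) : ℤ_[p] :=
  (-1) ^ (F.b i : ℕ) * (p : ℤ_[p]) ^ F.k i * x + F.dInt i

theorem coe_mapInt (F : PadicIFS p) (i : Fin F.n) (x : ℤ_[p]) :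
    (F.mapInt i x : ℚ_[p]) = F.map i x := by
  rw [mapInt, PadicInt.coe_add, PadicInt.coe_mul, PadicInt.coe_mul]
  simp [map, dInt]

/-- Terms of the address sum, as `p`-adic integers. -/
noncomputable def termInt (F : PadicIFS p) (a : ℕ → Fin F.n) (j : ℕ) : ℤ_[p] :=
  (-1) ^ (∑ i ∈ Finset.range j, (F.b (a i) : ℕ)) *
    (p : ℤ_[p]) ^ (∑ i ∈ Finset.range j, F.k (a i)) * F.dInt (a j)

theorem coe_termInt (F : PadicIFS p) (a : ℕ → Fin F.n) (j : ℕ) :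
    (F.termInt a j : ℚ_[p]) = F.addressTerm a j := by
  rw [termInt, PadicInt.coe_mul, PadicInt.coe_mul]
  simp [addressTerm, dInt]

theorem one_lt_p : 1 < p := (Fact.out : p.Prime).one_lt

theorem inv_p_lt_one : ((p : ℝ)⁻¹) < 1 :=
  inv_lt_one_of_one_lt₀ (by exact_mod_cast one_lt_p (p := p))

theorem inv_p_pos : 0 < ((p : ℝ)⁻¹) := by
  have := one_lt_p (p := p)
  positivity

theorem summable_termInt (F : PadicIFS p) (a : ℕ → Fin F.n) : Summable (F.termInt a) := by
  refine Summable.of_norm_bounded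
    (summable_geometric_of_lt_one inv_p_pos.le (inv_p_lt_one (p := p))) fun j => ?_
  rw [termInt, norm_mul, norm_mul, norm_pow, norm_neg, norm_one, one_pow, one_mul, norm_pow,
    PadicInt.norm_p]
  refine (mul_le_of_le_one_right (by positivity) (PadicInt.norm_le_one _)).trans ?_
  refine pow_le_pow_of_le_one inv_p_pos.le inv_p_lt_one.le ?_
  simpa using Finset.card_nsmul_le_sum (Finset.range j) (fun i => F.k (a i)) 1
    fun i _ => F.one_le_k _

/-- The point with a given address. -/
noncomputable def point (F : PadicIFS p) (a : ℕ → Fin F.n) : ℤ_[p] := ∑' j, F.termInt a j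

theorem isAddressSum_point (F : PadicIFS p) (a : ℕ → Fin F.n) :
    F.IsAddressSum a (F.point a) := by
  have := (F.summable_termInt a).hasSum.map PadicInt.Coe.ringHom continuous_subtype_val
  have e : F.addressTerm a = PadicInt.Coe.ringHom ∘ F.termInt a :=
    funext fun j => (F.coe_termInt a j).symm
  rw [IsAddressSum, e]
  exact this

theorem isAddressSum_iff (F : PadicIFS p) (a : ℕ → Fin F.n) (x : ℚ_[p]) :
    F.IsAddressSum a x ↔ x = F.point a :=
  ⟨fun h => h.unique (F.isAddressSum_point a), fun h => h ▸ F.isAddressSum_point a⟩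

theorem termInt_succ (F : PadicIFS p) (a : ℕ → Fin F.n) (j : ℕ) :
    F.termInt a (j + 1) =
      (-1) ^ (F.b (a 0) : ℕ) * (p : ℤ_[p]) ^ F.k (a 0) * F.termInt (fun i => a (i + 1)) j := by
  simp only [termInt, Finset.sum_range_succ', pow_add]
  ring

theorem point_eq (F : PadicIFS p) (a : ℕ → Fin F.n) :
    F.point a = F.mapInt (a 0) (F.point fun i => a (i + 1)) := by
  rw [point, (F.summable_termInt a).tsum_eq_zero_add, mapInt, point,
    ← (F.summable_termInt _).tsum_mul_left, add_comm]
  simp only [← termInt_succ]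
  simp [termInt]

/-- The composition of the maps along a finite address. -/
noncomputable def comp (F : PadicIFS p) (l : List (Fin F.n)) (x : ℤ_[p]) : ℤ_[p] :=
  l.foldr F.mapInt x

/-- The composition of the maps along a finite address, on `ℚ_[p]`. -/
noncomputable def compQ (F : PadicIFS p) (l : List (Fin F.n)) (x : ℚ_[p]) : ℚ_[p] :=
  l.foldr F.map x

theorem coe_comp (F : PadicIFS p) (l : List (Fin F.n)) (x : ℤ_[p]) :
    (F.comp l x : ℚ_[p]) = F.compQ l x := by
  induction l with
  | nil => rfl
  | cons i l ih => exact (F.coe_mapInt i (F.comp l x)).trans (congrArg _ ih)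

/-- The exponent of the contraction ratio of a finite address. -/
def kap (F : PadicIFS p) (l : List (Fin F.n)) : ℕ := (l.map F.k).sum

/-- The sign of a finite address. -/
def sgn (F : PadicIFS p) (l : List (Fin F.n)) : ℤˣ := (l.map fun i => (-1) ^ (F.b i : ℕ)).prod

@[simp] theorem kap_nil (F : PadicIFS p) : F.kap [] = 0 := rfl
@[simp] theorem kap_cons (F : PadicIFS p) (i : Fin F.n) (l : List (Fin F.n)) :
    F.kap (i :: l) = F.k i + F.kap l := by simp [kap]
@[simp] theorem sgn_nil (F : PadicIFS p) : F.sgn [] = 1 := rfl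
@[simp] theorem sgn_cons (F : PadicIFS p) (i : Fin F.n) (l : List (Fin F.n)) :
    F.sgn (i :: l) = (-1) ^ (F.b i : ℕ) * F.sgn l := by simp [sgn]

theorem length_le_kap (F : PadicIFS p) (l : List (Fin F.n)) : l.length ≤ F.kap l := by
  induction l with
  | nil => simp
  | cons i l ih => simpa [add_comm] using add_le_add (F.one_le_k i) ih

theorem comp_eq (F : PadicIFS p) (l : List (Fin F.n)) (x : ℤ_[p]) :
    F.comp l x = ((F.sgn l : ℤ) : ℤ_[p]) * (p : ℤ_[p]) ^ F.kap l * x + F.comp l 0 := by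
  induction l with
  | nil => simp [comp]
  | cons i l ih =>
    have h : ∀ y, F.comp (i :: l) y = F.mapInt i (F.comp l y) := fun y => rfl
    rw [h, h, ih, mapInt, mapInt]
    simp only [sgn_cons, kap_cons, pow_add]
    push_cast
    ring

theorem norm_map_sub (F : PadicIFS p) (i : Fin F.n) (x y : ℚ_[p]) :
    ‖F.map i x - F.map i y‖ = ((p : ℝ)⁻¹) ^ F.k i * ‖x - y‖ := by
  have : F.map i x - F.map i y = (-1) ^ (F.b i : ℕ) * (p : ℚ_[p]) ^ F.k i * (x - y) := by
    simp only [map]; ring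
  rw [this, norm_mul, norm_mul, norm_pow, norm_neg, norm_one, one_pow, one_mul, norm_pow,
    Padic.norm_p]

theorem norm_compQ_sub (F : PadicIFS p) (l : List (Fin F.n)) (x y : ℚ_[p]) :
    ‖F.compQ l x - F.compQ l y‖ = ((p : ℝ)⁻¹) ^ F.kap l * ‖x - y‖ := by
  induction l with
  | nil => simp [compQ]
  | cons i l ih =>
    have h : ∀ y, F.compQ (i :: l) y = F.map i (F.compQ l y) := fun y => rfl
    rw [h, h, norm_map_sub, ih, kap_cons, pow_add, mul_assoc]

theorem point_eq_comp (F : PadicIFS p) (a : ℕ → Fin F.n) (m : ℕ) :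
    F.point a = F.comp ((List.range m).map a) (F.point fun j => a (j + m)) := by
  induction m generalizing a with
  | zero => simp [comp]
  | succ m ih =>
    rw [point_eq, ih, List.range_succ_eq_map]
    simp only [comp, List.map_cons, List.foldr_cons, List.map_map]
    congr 2

/-- Each letter contracts by at least 1/p, so the starting point of a long composition hardly
matters. -/
theorem norm_compQ_sub_le (F : PadicIFS p) (a : ℕ → Fin F.n) (m : ℕ) (x : ℚ_[p]) :
    ‖F.compQ ((List.range m).map a) x - F.point a‖ ≤ ((p : ℝ)⁻¹) ^ m * (‖x‖ + 1) := by
  rw [F.point_eq_comp a m, coe_comp, norm_compQ_sub]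
  have h1 : m ≤ F.kap ((List.range m).map a) := by
    simpa using F.length_le_kap ((List.range m).map a)
  gcongr ?_ * ?_
  · exact pow_le_pow_of_le_one inv_p_pos.le inv_p_lt_one.le h1
  · exact (norm_sub_le _ _).trans (add_le_add le_rfl (PadicInt.norm_le_one _))

theorem tendsto_inv_p_pow_mul (C : ℝ) :
    Filter.Tendsto (fun m : ℕ => ((p : ℝ)⁻¹) ^ m * C) Filter.atTop (nhds 0) := by
  simpa using (tendsto_pow_atTop_nhds_zero_of_lt_one inv_p_pos.le
    (inv_p_lt_one (p := p))).mul_const C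

theorem compQ_mem (F : PadicIFS p) {K : Set ℚ_[p]} (h : ∀ i, Set.MapsTo (F.map i) K K)
    (l : List (Fin F.n)) {x : ℚ_[p]} (hx : x ∈ K) : F.compQ l x ∈ K := by
  induction l with
  | nil => exact hx
  | cons i l ih => exact h i ih

theorem point_mem_of_mapsTo (F : PadicIFS p) {K : Set ℚ_[p]} (hne : K.Nonempty)
    (hK : IsClosed K) (h : ∀ i, Set.MapsTo (F.map i) K K) (a : ℕ → Fin F.n) :
    (F.point a : ℚ_[p]) ∈ K := by
  obtain ⟨y, hy⟩ := hne
  refine hK.mem_of_tendsto (b := Filter.atTop)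
    (f := fun m : ℕ => F.compQ ((List.range m).map a) y) ?_
    (Filter.Eventually.of_forall fun m => F.compQ_mem h _ hy)
  rw [tendsto_iff_norm_sub_tendsto_zero]
  exact squeeze_zero (fun _ => norm_nonneg _) (fun m => F.norm_compQ_sub_le a m y)
    (tendsto_inv_p_pow_mul _)

/-- Choosing for each point of K a map and a preimage in K, and iterating, produces an address. The
successive preimages stay bounded because K is compact, so the error in the partial compositions
tends to 0. -/
theorem exists_point_eq (F : PadicIFS p) {K : Set ℚ_[p]} (hK : IsCompact K)
    (h : K ⊆ ⋃ i, F.map i '' K) {x : ℚ_[p]} (hx : x ∈ K) : ∃ a, (F.point a : ℚ_[p]) = x := by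
  have h' : ∀ y : K, ∃ (i : Fin F.n) (z : K), F.map i z = y := by
    rintro ⟨y, hy⟩
    obtain ⟨i, z, hz, e⟩ := Set.mem_iUnion.1 (h hy)
    exact ⟨i, ⟨z, hz⟩, e⟩
  choose i z e using h'
  let s : ℕ → K := fun n => z^[n] ⟨x, hx⟩
  have key : ∀ (m : ℕ) (y : K),
      F.compQ ((List.range m).map fun n => i (z^[n] y)) (z^[m] y) = y := by
    intro m
    induction m with
    | zero => intro y; rfl
    | succ m ih =>
      intro y
      have := ih (z y)
      rw [List.range_succ_eq_map]
      simp only [compQ, List.map_cons, List.foldr_cons, List.map_map] at this ⊢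
      refine Eq.trans ?_ (e y)
      exact congrArg _ this
  obtain ⟨C, hC⟩ := hK.isBounded.exists_norm_le
  refine ⟨fun n => i (s n), ?_⟩
  have h0 : ∀ m : ℕ, ‖x - F.point fun n => i (s n)‖ ≤ ((p : ℝ)⁻¹) ^ m * (C + 1) := fun m => by
    have := F.norm_compQ_sub_le (fun n => i (s n)) m (s m)
    rw [key m ⟨x, hx⟩] at this
    refine this.trans ?_
    have := hC _ (s m).2
    have := inv_p_pos (p := p)
    gcongr
  have := ge_of_tendsto' (tendsto_inv_p_pow_mul (p := p) (C + 1)) h0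
  exact (sub_eq_zero.1 (norm_le_zero_iff.1 this)).symm

theorem IsAttractor.eq_range {F : PadicIFS p} {K : Set ℚ_[p]} (h : F.IsAttractor K) :
    K = (fun x : ℤ_[p] => (x : ℚ_[p])) '' Set.range F.point := by
  obtain ⟨hne, hc, he⟩ := h
  refine Set.Subset.antisymm (fun x hx => ?_) ?_
  · obtain ⟨a, ha⟩ := F.exists_point_eq hc he.subset hx
    exact ⟨_, ⟨a, rfl⟩, ha⟩
  · rintro _ ⟨_, ⟨a, rfl⟩, rfl⟩
    refine F.point_mem_of_mapsTo hne hc.isClosed (fun i x hx => ?_) a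
    rw [he]
    exact Set.mem_iUnion.2 ⟨i, x, hx, rfl⟩

theorem IsAttractor.mem_iff {F : PadicIFS p} {K : Set ℚ_[p]} (h : F.IsAttractor K) (x : ℚ_[p]) :
    x ∈ K ↔ ∃ a, F.IsAddressSum a x := by
  simp only [isAddressSum_iff]
  conv_lhs => rw [h.eq_range]
  simp [eq_comm]

theorem comp_mem_range (F : PadicIFS p) (l : List (Fin F.n)) {x : ℤ_[p]}
    (hx : x ∈ Set.range F.point) : F.comp l x ∈ Set.range F.point := by
  induction l with
  | nil => exact hx
  | cons i l ih =>
    obtain ⟨a, ha⟩ := ih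
    refine ⟨fun n => Nat.casesOn n i a, ?_⟩
    rw [point_eq]
    exact congrArg _ ha

/-! ### Integer bounds over the common denominator -/

/-- The common denominator of the translation parts. -/
def den (F : PadicIFS p) : ℕ := ∏ i, (F.d i).den

/-- The numerators of the translation parts over the common denominator. -/
def num (F : PadicIFS p) (i : Fin F.n) : ℤ := (F.d i).num * (F.den / (F.d i).den : ℕ)

/-- A bound for the numerators over the common denominator. -/
def numBound (F : PadicIFS p) : ℕ := F.den * ∑ i, (F.d i).num.natAbs

theorem den_pos (F : PadicIFS p) : 0 < F.den := Finset.prod_pos fun i _ => (F.d i).den_pos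

theorem den_mul_d (F : PadicIFS p) (i : Fin F.n) : (F.den : ℚ) * F.d i = F.num i := by
  obtain ⟨c, hc⟩ : (F.d i).den ∣ F.den := Finset.dvd_prod_of_mem _ (Finset.mem_univ i)
  have h0 := (F.d i).den_pos
  rw [num, hc, Nat.mul_div_cancel_left _ h0]
  push_cast
  conv_lhs => rw [mul_right_comm, Rat.den_mul_eq_num]

theorem den_mul_dInt (F : PadicIFS p) (i : Fin F.n) : (F.den : ℤ_[p]) * F.dInt i = F.num i := by
  apply PadicInt.ext
  have := congrArg (fun q : ℚ => (q : ℚ_[p])) (F.den_mul_d i)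
  rw [PadicInt.coe_mul]
  simpa [dInt] using this

theorem natAbs_num_le (F : PadicIFS p) (i : Fin F.n) : (F.num i).natAbs ≤ F.numBound := by
  rw [num, numBound, Int.natAbs_mul, mul_comm, Int.natAbs_natCast]
  exact Nat.mul_le_mul (Nat.div_le_self _ _)
    (Finset.single_le_sum (f := fun i => (F.d i).num.natAbs) (fun _ _ => Nat.zero_le _)
      (Finset.mem_univ i))

theorem isUnit_den (F : PadicIFS p) : IsUnit (F.den : ℤ_[p]) := by
  rw [den]
  push_cast
  refine IsUnit.prod_univ_iff.2 fun i => ?_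
  have := PadicInt.isUnit_den (F.d i) (F.d_mem i)
  exact this

theorem coprime_den (F : PadicIFS p) (k : ℕ) : (p ^ k).Coprime F.den := by
  refine Nat.Coprime.pow_left k ?_
  have := PadicInt.isUnit_iff.1 F.isUnit_den
  exact (PadicInt.norm_natCast_eq_one_iff.1 this)

/-- The translation part of `comp l`, scaled by the common denominator. -/
def numComp (F : PadicIFS p) (l : List (Fin F.n)) : ℤ :=
  l.foldr (fun i x => (-1) ^ (F.b i : ℕ) * (p : ℤ) ^ F.k i * x + F.num i) 0

theorem den_mul_comp (F : PadicIFS p) (l : List (Fin F.n)) :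
    (F.den : ℤ_[p]) * F.comp l 0 = F.numComp l := by
  induction l with
  | nil => simp [comp, numComp]
  | cons i l ih =>
    have h1 : F.comp (i :: l) 0 = F.mapInt i (F.comp l 0) := rfl
    have h2 : F.numComp (i :: l) =
      (-1) ^ (F.b i : ℕ) * (p : ℤ) ^ F.k i * F.numComp l + F.num i := rfl
    rw [h1, h2, mapInt, mul_add, den_mul_dInt]
    push_cast
    rw [← ih]
    ring

/-- The term -1 makes the induction close: E p^k (p^κ - 1) + E ≤ E (p^(k+κ) - 1) because p^k ≥ 2. -/
theorem abs_numComp_le (F : PadicIFS p) (l : List (Fin F.n)) :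
    |F.numComp l| ≤ F.numBound * ((p : ℤ) ^ F.kap l - 1) := by
  induction l with
  | nil => simp [numComp]
  | cons i l ih =>
    have h2 : F.numComp (i :: l) =
      (-1) ^ (F.b i : ℕ) * (p : ℤ) ^ F.k i * F.numComp l + F.num i := rfl
    have h3 : |F.num i| ≤ F.numBound := by
      rw [Int.abs_eq_natAbs]; exact_mod_cast F.natAbs_num_le i
    have hp : (2 : ℤ) ≤ (p : ℤ) ^ F.k i := by
      have h : (2 : ℤ) ≤ p := by exact_mod_cast one_lt_p (p := p)
      exact h.trans (le_self_pow₀ (by linarith) (by have := F.one_le_k i; omega))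
    have hE : (0 : ℤ) ≤ F.numBound := by positivity
    rw [h2, kap_cons, pow_add]
    refine (abs_add_le _ _).trans ?_
    rw [abs_mul, abs_mul, abs_pow, abs_neg, abs_one, one_pow, one_mul, abs_of_nonneg (by linarith)]
    nlinarith [mul_le_mul_of_nonneg_left ih (by linarith : (0 : ℤ) ≤ (p : ℤ) ^ F.k i)]

end PadicIFS

/-! ### Standard expansions of p-adic integers -/

section Expansions

variable {p : ℕ}

/-- The number with a given list of base `p` digits, least significant digit first. -/
def digitsVal (u : List (Fin p)) : ℕ := Nat.ofDigits p (u.map Fin.val)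

theorem digitsVal_append (u v : List (Fin p)) :
    digitsVal (u ++ v) = digitsVal u + p ^ u.length * digitsVal v := by
  simp [digitsVal, Nat.ofDigits_append]

theorem digitsVal_cons (a : Fin p) (u : List (Fin p)) :
    digitsVal (a :: u) = a + p * digitsVal u := by
  simp [digitsVal, Nat.ofDigits_cons]

variable [Fact p.Prime]

theorem digitsVal_lt (u : List (Fin p)) : digitsVal u < p ^ u.length := by
  have := Nat.ofDigits_lt_base_pow_length (l := u.map Fin.val) (PadicIFS.one_lt_p (p := p))
    (by simp)
  simpa [digitsVal] using this

theorem digitsVal_inj {u v : List (Fin p)} (hl : u.length = v.length)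
    (h : digitsVal u = digitsVal v) : u = v := by
  refine List.map_injective_iff.2 Fin.val_injective ?_
  exact Nat.ofDigits_inj_of_len_eq (PadicIFS.one_lt_p (p := p)) (by simpa using hl) (by simp)
    (by simp) h

theorem exists_digitsVal_eq (k : ℕ) {U : ℕ} (hU : U < p ^ k) :
    ∃ u : List (Fin p), u.length = k ∧ digitsVal u = U := by
  induction k generalizing U with
  | zero => exact ⟨[], rfl, by simpa [digitsVal, eq_comm] using hU⟩
  | succ k ih =>
    have hp := PadicIFS.one_lt_p (p := p)
    obtain ⟨u, hu, e⟩ := ih (U := U / p)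
      (by rw [Nat.div_lt_iff_lt_mul (by omega), ← pow_succ]; exact hU)
    refine ⟨⟨U % p, Nat.mod_lt _ (by omega)⟩ :: u, by simp [hu], ?_⟩
    rw [digitsVal_cons, e]
    exact Nat.mod_add_div U p

theorem PadicInt.pow_p_dvd_iff_norm_le (m : ℕ) (x : ℤ_[p]) :
    (p : ℤ_[p]) ^ m ∣ x ↔ ‖x‖ ≤ ((p : ℝ)⁻¹) ^ m := by
  rw [← Ideal.mem_span_singleton, ← PadicInt.norm_le_pow_iff_mem_span_pow]
  simp

theorem natCast_eq_of_pow_dvd_sub {m U V : ℕ} {x : ℤ_[p]} (hU : U < p ^ m) (hV : V < p ^ m)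
    (h1 : (p : ℤ_[p]) ^ m ∣ x - U) (h2 : (p : ℤ_[p]) ^ m ∣ x - V) : U = V := by
  have h3 := dvd_sub h2 h1
  have h4 : x - V - (x - U) = ((U - V : ℤ) : ℤ_[p]) := by push_cast; ring
  rw [h4, PadicInt.pow_p_dvd_int_iff] at h3
  have h5 : (U : ℤ) ≡ V [ZMOD ((p ^ m : ℕ) : ℤ)] := by
    rw [Int.modEq_comm, Int.modEq_iff_dvd]; exact_mod_cast h3
  exact Nat.ModEq.eq_of_lt_of_lt (Int.natCast_modEq_iff.1 h5) hU hV

/-- The first `m` letters of an infinite word. -/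
def wordPrefix {A : Type} (w : ℕ → A) (m : ℕ) : List A := (List.range m).map w

@[simp] theorem length_wordPrefix {A : Type} (w : ℕ → A) (m : ℕ) :
    (wordPrefix w m).length = m := by simp [wordPrefix]

theorem wordPrefix_add {A : Type} (w : ℕ → A) (m n : ℕ) :
    wordPrefix w (m + n) = wordPrefix w m ++ wordPrefix (fun j => w (m + j)) n := by
  simp only [wordPrefix, List.range_add, List.map_append, List.map_map]
  rfl

theorem wordPrefix_succ {A : Type} (w : ℕ → A) (m : ℕ) :
    wordPrefix w (m + 1) = wordPrefix w m ++ [w m] := by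
  simp [wordPrefix, List.range_succ]

theorem pow_dvd_digitsVal_sub (w : ℕ → Fin p) {m n : ℕ} (h : m ≤ n) :
    (p : ℤ_[p]) ^ m ∣ (digitsVal (wordPrefix w n) : ℤ_[p]) - digitsVal (wordPrefix w m) := by
  obtain ⟨k, rfl⟩ := Nat.exists_eq_add_of_le h
  rw [wordPrefix_add, digitsVal_append]
  push_cast
  simp

theorem sum_range_eq_digitsVal (w : ℕ → Fin p) (m : ℕ) :
    ∑ i ∈ Finset.range m, ((w i : ℕ) : ℤ_[p]) * (p : ℤ_[p]) ^ i =
      digitsVal (wordPrefix w m) := by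
  induction m with
  | zero => simp [wordPrefix, digitsVal]
  | succ m ih =>
    rw [Finset.sum_range_succ, ih, wordPrefix_succ, digitsVal_append]
    simp [digitsVal, mul_comm]

theorem summable_digits (w : ℕ → Fin p) :
    Summable fun i => ((w i : ℕ) : ℤ_[p]) * (p : ℤ_[p]) ^ i := by
  refine Summable.of_norm_bounded (summable_geometric_of_lt_one PadicIFS.inv_p_pos.le
    (PadicIFS.inv_p_lt_one (p := p))) fun j => ?_
  rw [norm_mul, norm_pow, PadicInt.norm_p]
  exact mul_le_of_le_one_left (by positivity) (PadicInt.norm_le_one _)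

/-- The `p`-adic integer with a given standard expansion. -/
noncomputable def wordVal (w : ℕ → Fin p) : ℤ_[p] := ∑' i, ((w i : ℕ) : ℤ_[p]) * (p : ℤ_[p]) ^ i

theorem isPadicExpansion_wordVal (w : ℕ → Fin p) : IsPadicExpansion p w (wordVal w) := by
  have := (summable_digits w).hasSum.map PadicInt.Coe.ringHom continuous_subtype_val
  have e : (fun i => ((w i : ℕ) : ℚ_[p]) * (p : ℚ_[p]) ^ i) = PadicInt.Coe.ringHom ∘
      fun i => ((w i : ℕ) : ℤ_[p]) * (p : ℤ_[p]) ^ i := by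
    ext i
    simp
  rw [IsPadicExpansion, e]
  exact this

theorem isPadicExpansion_iff_eq (w : ℕ → Fin p) (x : ℚ_[p]) :
    IsPadicExpansion p w x ↔ x = wordVal w :=
  ⟨fun h => h.unique (isPadicExpansion_wordVal w), fun h => h ▸ isPadicExpansion_wordVal w⟩

theorem pow_dvd_wordVal_sub (w : ℕ → Fin p) (m : ℕ) :
    (p : ℤ_[p]) ^ m ∣ wordVal w - digitsVal (wordPrefix w m) := by
  rw [PadicInt.pow_p_dvd_iff_norm_le]
  have h := (summable_digits w).hasSum.tendsto_sum_nat
  simp only [sum_range_eq_digitsVal] at h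
  refine le_of_tendsto ((h.sub_const _).norm) ?_
  filter_upwards [Filter.eventually_ge_atTop m] with n hn
  exact (PadicInt.pow_p_dvd_iff_norm_le _ _).1 (pow_dvd_digitsVal_sub w hn)

theorem PadicInt.eq_of_forall_pow_dvd_sub {x y : ℤ_[p]}
    (h : ∀ m : ℕ, (p : ℤ_[p]) ^ m ∣ x - y) : x = y := by
  have := ge_of_tendsto' (PadicIFS.tendsto_inv_p_pow_mul (p := p) 1)
    fun m => by simpa using (PadicInt.pow_p_dvd_iff_norm_le _ _).1 (h m)
  exact sub_eq_zero.1 (norm_le_zero_iff.1 this)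

theorem eq_wordVal_iff (w : ℕ → Fin p) (x : ℤ_[p]) :
    x = wordVal w ↔ ∀ m, (p : ℤ_[p]) ^ m ∣ x - digitsVal (wordPrefix w m) := by
  refine ⟨fun h m => h ▸ pow_dvd_wordVal_sub w m, fun h => ?_⟩
  refine PadicInt.eq_of_forall_pow_dvd_sub fun m => ?_
  simpa using dvd_sub (h m) (pow_dvd_wordVal_sub w m)

theorem exists_wordVal_eq (x : ℤ_[p]) : ∃ w, wordVal w = x := by
  have hp := PadicIFS.one_lt_p (p := p)
  -- The i-th digit is the leading base p digit of the residue of x modulo p^(i+1).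
  let w : ℕ → Fin p := fun i => ⟨(x.appr (i + 1) / p ^ i) % p, Nat.mod_lt _ (by omega)⟩
  have key : ∀ m, digitsVal (wordPrefix w m) = x.appr m := by
    intro m
    induction m with
    | zero => simpa [wordPrefix, digitsVal, eq_comm] using x.appr_lt 0
    | succ m ih =>
      rw [wordPrefix_succ, digitsVal_append, ih, length_wordPrefix]
      have h1 := x.dvd_appr_sub_appr m (m + 1) (Nat.le_succ m)
      have h2 := x.appr_mono (Nat.le_succ m)
      have h3 := x.appr_lt m
      have h4 := x.appr_lt (m + 1)
      obtain ⟨c, hc⟩ := h1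
      have h5 : x.appr (m + 1) = x.appr m + p ^ m * c := by
        have : x.appr m ≤ x.appr (m + 1) := h2
        omega
      have h6 : x.appr (m + 1) / p ^ m = c := by
        rw [h5, Nat.add_mul_div_left _ _ (by positivity), Nat.div_eq_of_lt h3, zero_add]
      have h7 : c < p := by
        rw [← h6, Nat.div_lt_iff_lt_mul (by positivity), ← pow_succ']
        exact h4
      have h8 : digitsVal [w m] = c := by
        simp [digitsVal, w, h6, Nat.mod_eq_of_lt h7]
      rw [h8, h5]
  refine ⟨w, ((eq_wordVal_iff w x).2 fun m => ?_).symm⟩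
  rw [key, ← Ideal.mem_span_singleton]
  exact x.appr_spec m

end Expansions

/-! ### The transducer -/

namespace PadicIFS

variable {p : ℕ} [Fact p.Prime]

/-- U is the residue of c/D modulo p^k, which makes sense as D is invertible there; c' is what
remains after division by p^k. -/
theorem exists_carry {k D : ℕ} (h : (p ^ k).Coprime D) (c : ℤ) :
    ∃ (U : ℕ) (c' : ℤ), U < p ^ k ∧ c = D * U + (p : ℤ) ^ k * c' := by
  have : NeZero (p ^ k) := ⟨by have := one_lt_p (p := p); positivity⟩
  let U := ((c : ZMod (p ^ k)) * (D : ZMod (p ^ k))⁻¹).val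
  have h1 : ((D * U : ℤ) : ZMod (p ^ k)) = c := by
    have := ZMod.coe_mul_inv_eq_one D h.symm
    rw [Int.cast_mul, Int.cast_natCast, Int.cast_natCast, ZMod.natCast_zmod_val, mul_left_comm,
      this, mul_one]
  rw [ZMod.intCast_eq_intCast_iff_dvd_sub] at h1
  obtain ⟨c', hc'⟩ := h1
  refine ⟨U, c', ZMod.val_lt _, ?_⟩
  push_cast at hc'
  linarith

/-- The states of the transducer: pairs (carry, sign). -/
noncomputable def states (F : PadicIFS p) : Finset (ℚ × ℤˣ) :=
  (Finset.Icc (-(F.numBound + 2 * F.den : ℤ)) (F.numBound + 2 * F.den) ×ˢ Finset.univ).image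
    fun c => ((c.1 : ℚ) / F.den, c.2)

theorem mem_states (F : PadicIFS p) (q : ℚ × ℤˣ) :
    q ∈ F.states ↔ ∃ c : ℤ, |c| ≤ F.numBound + 2 * F.den ∧ q.1 = c / F.den := by
  simp only [states, Finset.mem_image, Finset.mem_product, Finset.mem_univ, and_true,
    Finset.mem_Icc, abs_le]
  constructor
  · rintro ⟨c, hc, rfl⟩
    exact ⟨c.1, hc, rfl⟩
  · rintro ⟨c, hc, e⟩
    exact ⟨(c, q.2), hc, Prod.ext e.symm rfl⟩

theorem norm_den (F : PadicIFS p) : ‖(F.den : ℚ_[p])‖ = 1 := by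
  have := PadicInt.isUnit_iff.1 F.isUnit_den
  rw [PadicInt.norm_def] at this
  exact_mod_cast this

theorem norm_le_one_of_mem_states (F : PadicIFS p) {q : ℚ × ℤˣ} (h : q ∈ F.states) :
    ‖(q.1 : ℚ_[p])‖ ≤ 1 := by
  obtain ⟨c, -, e⟩ := (F.mem_states q).1 h
  rw [e]
  push_cast
  rw [norm_div, F.norm_den, div_one]
  exact Padic.norm_int_le_one c

/-- The transducer that rewrites address sums into standard expansions. -/
noncomputable def transducer (F : PadicIFS p) : Transducer (Fin F.n) (Fin p) F.states where
  init := ⟨(0, 1), (F.mem_states _).2 ⟨0, by simp; positivity, by simp⟩⟩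
  trans := {t | t.2.2.2.length = F.k t.2.1 ∧
    t.1.1.1 + ((t.1.1.2 : ℤ) : ℚ) * F.d t.2.1 =
      digitsVal t.2.2.2 + (p : ℚ) ^ F.k t.2.1 * t.2.2.1.1.1 ∧
    t.2.2.1.1.2 = (-1) ^ (F.b t.2.1 : ℕ) * t.1.1.2}

theorem mem_trans (F : PadicIFS p) (q : F.states) (i : Fin F.n) (q' : F.states)
    (u : List (Fin p)) : (q, i, q', u) ∈ F.transducer.trans ↔ u.length = F.k i ∧
      q.1.1 + ((q.1.2 : ℤ) : ℚ) * F.d i = digitsVal u + (p : ℚ) ^ F.k i * q'.1.1 ∧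
      q'.1.2 = (-1) ^ (F.b i : ℕ) * q.1.2 := Iff.rfl

theorem exists_transition (F : PadicIFS p) (q : F.states) (i : Fin F.n) :
    ∃ (q' : F.states) (u : List (Fin p)), (q, i, q', u) ∈ F.transducer.trans := by
  obtain ⟨c, hc, e⟩ := (F.mem_states _).1 q.2
  obtain ⟨U, c', hU, h⟩ := exists_carry (F.coprime_den (F.k i)) (c + q.1.2 * F.num i)
  obtain ⟨u, hu, rfl⟩ := exists_digitsVal_eq _ hU
  have hD := F.den_pos
  have hD' : (F.den : ℚ) ≠ 0 := by positivity
  have hp : (2 : ℤ) ≤ (p : ℤ) ^ F.k i := by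
    have h : (2 : ℤ) ≤ p := by exact_mod_cast one_lt_p (p := p)
    exact h.trans (le_self_pow₀ (by linarith) (by have := F.one_le_k i; omega))
  -- With E = `F.numBound` and D = `F.den`, p^k c' is c ± num minus D times a block value below p^k.
  -- The first part is at most 2E + 2D ≤ p^k (E + D) in absolute value, as p^k ≥ 2, and the second
  -- is at most D p^k: hence the bound E + 2D reproduces itself.
  have hc' : |c'| ≤ F.numBound + 2 * F.den := by
    have h3 : |F.num i| ≤ F.numBound := by
      rw [Int.abs_eq_natAbs]; exact_mod_cast F.natAbs_num_le i
    have h4 : |(q.1.2 : ℤ) * F.num i| ≤ F.numBound := by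
      rwa [abs_mul, Int.abs_eq_natAbs (q.1.2 : ℤ), Int.units_natAbs, Nat.cast_one, one_mul]
    have hU' : (digitsVal u : ℤ) ≤ (p : ℤ) ^ F.k i - 1 := by
      have : (digitsVal u : ℤ) < (p : ℤ) ^ F.k i := by exact_mod_cast hU
      linarith
    have h0 : (0 : ℤ) ≤ F.den * digitsVal u := by positivity
    have h1 : (F.den : ℤ) * digitsVal u ≤ F.den * ((p : ℤ) ^ F.k i - 1) := by gcongr
    have hE : (0 : ℤ) ≤ F.numBound := by positivity
    have hD0 : (0 : ℤ) ≤ F.den := by positivity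
    rw [abs_le] at hc h4 ⊢
    have h5 : ((p : ℤ) ^ F.k i - 2) * (F.numBound + F.den) ≥ 0 :=
      mul_nonneg (by linarith) (by linarith)
    have hpos : (0 : ℤ) < (p : ℤ) ^ F.k i := by linarith
    constructor
    · refine le_of_mul_le_mul_left ?_ hpos
      linarith
    · refine le_of_mul_le_mul_left ?_ hpos
      linarith
  refine ⟨⟨((c' : ℚ) / F.den, (-1) ^ (F.b i : ℕ) * q.1.2), (F.mem_states _).2 ⟨c', hc', rfl⟩⟩, u,
    hu, ?_, rfl⟩
  have h' := congrArg (fun z : ℤ => (z : ℚ)) h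
  have hd := F.den_mul_d i
  push_cast at h'
  change q.1.1 + ((q.1.2 : ℤ) : ℚ) * F.d i = digitsVal u + (p : ℚ) ^ F.k i * ((c' : ℚ) / F.den)
  rw [e]
  refine mul_left_cancel₀ hD' ?_
  have e1 : (F.den : ℚ) * (c / F.den + ((q.1.2 : ℤ) : ℚ) * F.d i) =
      c + ((q.1.2 : ℤ) : ℚ) * F.num i := by
    rw [← hd]; field_simp
  rw [e1, h']
  field_simp

/-- Carries are p-adic integers, so the block is determined by the left-hand side modulo p^k; the
new carry is then forced. -/
theorem transition_unique (F : PadicIFS p) {q : F.states} {i : Fin F.n} {q₁ q₂ : F.states}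
    {u₁ u₂ : List (Fin p)} (h₁ : (q, i, q₁, u₁) ∈ F.transducer.trans)
    (h₂ : (q, i, q₂, u₂) ∈ F.transducer.trans) : q₁ = q₂ ∧ u₁ = u₂ := by
  rw [mem_trans] at h₁ h₂
  have hu : u₁ = u₂ := by
    refine digitsVal_inj (h₁.1.trans h₂.1.symm) ?_
    let s₁ : ℤ_[p] := ⟨_, F.norm_le_one_of_mem_states q₁.2⟩
    let s₂ : ℤ_[p] := ⟨_, F.norm_le_one_of_mem_states q₂.2⟩
    have h : (digitsVal u₁ : ℤ_[p]) + (p : ℤ_[p]) ^ F.k i * s₁ =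
        digitsVal u₂ + (p : ℤ_[p]) ^ F.k i * s₂ := by
      have h := congrArg (fun x : ℚ => (x : ℚ_[p])) (h₁.2.1.symm.trans h₂.2.1)
      apply PadicInt.ext
      rw [PadicInt.coe_add, PadicInt.coe_add, PadicInt.coe_mul, PadicInt.coe_mul]
      push_cast at h ⊢
      exact h
    refine natCast_eq_of_pow_dvd_sub (p := p) (m := F.k i)
      (x := (digitsVal u₁ : ℤ_[p]) + (p : ℤ_[p]) ^ F.k i * s₁)
      (h₁.1 ▸ digitsVal_lt u₁) (h₂.1 ▸ digitsVal_lt u₂) (by simp) (by rw [h]; simp)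
  subst hu
  have hp : (p : ℚ) ^ F.k i ≠ 0 := by have := one_lt_p (p := p); positivity
  refine ⟨Subtype.ext (Prod.ext ?_ (h₁.2.2.trans h₂.2.2.symm)), rfl⟩
  exact mul_left_cancel₀ hp (add_left_cancel (h₁.2.1.symm.trans h₂.2.1))

theorem transducer_isSequential (F : PadicIFS p) : F.transducer.IsSequential := by
  intro q i
  obtain ⟨q', u, h⟩ := F.exists_transition q i
  refine ⟨(q', u), h, fun r hr => ?_⟩
  obtain ⟨h1, h2⟩ := F.transition_unique hr h
  exact Prod.ext h1 h2

/-- One step expands the remaining address sum by `point_eq` and substitutes the transition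
equation. -/
theorem run_invariant (F : PadicIFS p) {a : ℕ → Fin F.n} {q : ℕ → F.states}
    {u : ℕ → List (Fin p)} (h0 : q 0 = F.transducer.init)
    (h : ∀ j, (q j, a j, q (j + 1), u j) ∈ F.transducer.trans) (m : ℕ) :
    (F.point a : ℚ_[p]) = digitsVal ((List.range m).map u).flatten +
      (p : ℚ_[p]) ^ ((List.range m).map u).flatten.length *
        (((q m).1.1 : ℚ_[p]) + (((q m).1.2 : ℤ) : ℚ_[p]) * F.point fun j => a (j + m)) := by
  induction m with
  | zero => simp [h0, transducer, digitsVal]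
  | succ m ih =>
    obtain ⟨h1, h2, h3⟩ := (F.mem_trans _ _ _ _).1 (h m)
    rw [ih, F.point_eq fun j => a (j + m), coe_mapInt, map]
    have h2' := congrArg (fun x : ℚ => (x : ℚ_[p])) h2
    push_cast at h2'
    simp only [List.range_succ, List.map_append, List.map_cons, List.map_nil, List.flatten_append,
      List.flatten_cons, List.flatten_nil, List.append_nil, digitsVal_append, List.length_append,
      pow_add, h1, h3, zero_add]
    have e : (fun i => a (i + 1 + m)) = fun j => a (j + (m + 1)) := by
      ext j; congr 2; omega
    rw [e]
    push_cast
    linear_combination (p : ℚ_[p]) ^ ((List.range m).map u).flatten.length * h2'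

theorem pow_dvd_point_sub_flatten (F : PadicIFS p) {a : ℕ → Fin F.n} {q : ℕ → F.states}
    {u : ℕ → List (Fin p)} (h0 : q 0 = F.transducer.init)
    (h : ∀ j, (q j, a j, q (j + 1), u j) ∈ F.transducer.trans) (m : ℕ) :
    (p : ℤ_[p]) ^ ((List.range m).map u).flatten.length ∣
      F.point a - digitsVal ((List.range m).map u).flatten := by
  let s : ℤ_[p] := ⟨_, F.norm_le_one_of_mem_states (q m).2⟩
  refine ⟨s + (((q m).1.2 : ℤ) : ℤ_[p]) * F.point fun j => a (j + m), ?_⟩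
  have := F.run_invariant h0 h m
  rw [sub_eq_iff_eq_add']
  apply PadicInt.ext
  rw [PadicInt.coe_add, PadicInt.coe_mul, PadicInt.coe_add, PadicInt.coe_mul, this]
  push_cast
  rfl

theorem le_length_flatten (F : PadicIFS p) {a : ℕ → Fin F.n} {q : ℕ → F.states}
    {u : ℕ → List (Fin p)} (h : ∀ j, (q j, a j, q (j + 1), u j) ∈ F.transducer.trans) (m : ℕ) :
    m ≤ ((List.range m).map u).flatten.length := by
  induction m with
  | zero => simp
  | succ m ih =>
    have h1 := ((F.mem_trans _ _ _ _).1 (h m)).1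
    have h2 := F.one_le_k (a m)
    rw [List.range_succ]
    simp only [List.map_append, List.map_cons, List.map_nil, List.flatten_append,
      List.flatten_cons, List.flatten_nil, List.append_nil, List.length_append]
    omega

theorem exists_run (F : PadicIFS p) (a : ℕ → Fin F.n) :
    ∃ (q : ℕ → F.states) (u : ℕ → List (Fin p)), q 0 = F.transducer.init ∧
      ∀ j, (q j, a j, q (j + 1), u j) ∈ F.transducer.trans := by
  choose next out h using F.exists_transition
  let q : ℕ → F.states := fun j => Nat.rec F.transducer.init (fun j s => next s (a j)) j
  exact ⟨q, fun j => out (q j) (a j), rfl, fun j => h (q j) (a j)⟩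

/-- By the invariant, the output after m letters agrees with x_a modulo p to its length, and this
length is at least m. Digits below p are determined by residues, so the output is the expansion of
x_a and nothing else. -/
theorem transducer_writes_iff (F : PadicIFS p) (a : ℕ → Fin F.n) (w : ℕ → Fin p) :
    F.transducer.Writes a w ↔ ∃ x, F.IsAddressSum a x ∧ IsPadicExpansion p w x := by
  simp only [isAddressSum_iff, isPadicExpansion_iff_eq, exists_eq_left]
  have hc : (F.point a : ℚ_[p]) = wordVal w ↔ F.point a = wordVal w :=
    ⟨fun h => PadicInt.ext h, fun h => congrArg _ h⟩
  rw [hc, eq_wordVal_iff]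
  constructor
  · rintro ⟨q, u, h0, h, hw, hN⟩ m
    -- Position m need not be the end of an output block, so the comparison is made at a later block
    -- boundary and truncated.
    obtain ⟨M, hM⟩ := hN m
    have h1 := F.pow_dvd_point_sub_flatten h0 h M
    rw [hw M] at h1
    have h2 := pow_dvd_digitsVal_sub w hM
    simp only [List.length_map, List.length_range] at h1
    have := dvd_add ((pow_dvd_pow _ hM).trans h1) h2
    simpa [wordPrefix] using this
  · intro hx
    obtain ⟨q, u, h0, h⟩ := F.exists_run a
    refine ⟨q, u, h0, h, fun m => ?_, fun N => ⟨N, F.le_length_flatten h N⟩⟩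
    refine digitsVal_inj (by simp) ?_
    refine natCast_eq_of_pow_dvd_sub (p := p) (digitsVal_lt _) ?_
      (F.pow_dvd_point_sub_flatten h0 h m) (hx _)
    exact (digitsVal_lt _).trans_eq (by simp)

end PadicIFS

/-! ### Residuals and prefix counts -/

section Residuals

variable {p : ℕ} [Fact p.Prime]

/-- The `p`-adic integers that can follow the digits `u` in the expansion of a point of `X`. -/
def residualSet (u : List (Fin p)) (X : Set ℤ_[p]) : Set ℤ_[p] :=
  {y | (digitsVal u : ℤ_[p]) + (p : ℤ_[p]) ^ u.length * y ∈ X}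

@[simp] theorem residualSet_nil (X : Set ℤ_[p]) : residualSet [] X = X := by
  simp [residualSet, digitsVal]

theorem residualSet_append (u v : List (Fin p)) (X : Set ℤ_[p]) :
    residualSet (u ++ v) X = residualSet v (residualSet u X) := by
  ext y
  simp only [residualSet, Set.mem_ofPred_eq, digitsVal_append, List.length_append, pow_add]
  have e : ((digitsVal u + p ^ u.length * digitsVal v : ℕ) : ℤ_[p]) +
      (p : ℤ_[p]) ^ u.length * (p : ℤ_[p]) ^ v.length * y =
      digitsVal u + (p : ℤ_[p]) ^ u.length * (digitsVal v + (p : ℤ_[p]) ^ v.length * y) := by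
    push_cast; ring
  rw [e]

theorem residualSet_cons (a : Fin p) (u : List (Fin p)) (X : Set ℤ_[p]) :
    residualSet (a :: u) X = residualSet u (residualSet [a] X) := residualSet_append [a] u X

theorem Set.Nonempty.of_residual {u : List (Fin p)} {X : Set ℤ_[p]}
    (h : (residualSet u X).Nonempty) : X.Nonempty := ⟨_, h.some_mem⟩

theorem residualSet_nonempty_iff (u : List (Fin p)) (X : Set ℤ_[p]) :
    (residualSet u X).Nonempty ↔ ∃ x ∈ X, (p : ℤ_[p]) ^ u.length ∣ x - digitsVal u := by
  constructor
  · rintro ⟨y, hy⟩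
    exact ⟨_, hy, y, by ring⟩
  · rintro ⟨x, hx, y, hy⟩
    refine ⟨y, ?_⟩
    rw [residualSet, Set.mem_ofPred_eq, ← hy]
    simpa using hx

/-- The words of length `m` that begin the expansion of a point of `X`. -/
def prefixes (m : ℕ) (X : Set ℤ_[p]) : Set (List (Fin p)) :=
  {u | u.length = m ∧ (residualSet u X).Nonempty}

theorem finite_prefixes (m : ℕ) (X : Set ℤ_[p]) : (prefixes m X).Finite :=
  (List.finite_length_eq (Fin p) m).subset fun _ h => h.1

/-- The number of words of length `m` that begin the expansion of a point of `X`. -/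
noncomputable def prefixCount (m : ℕ) (X : Set ℤ_[p]) : ℕ := (prefixes m X).ncard

theorem prefixCount_zero {X : Set ℤ_[p]} (h : X.Nonempty) : prefixCount 0 X = 1 := by
  rw [prefixCount, Set.ncard_eq_one]
  refine ⟨[], Set.ext fun u => ?_⟩
  simp only [prefixes, Set.mem_ofPred_eq, List.length_eq_zero_iff, Set.mem_singleton_iff]
  exact ⟨fun h => h.1, fun e => ⟨e, by simpa [e] using h⟩⟩

theorem prefixCount_succ (m : ℕ) (X : Set ℤ_[p]) :
    prefixCount (m + 1) X = ∑ a, prefixCount m (residualSet [a] X) := by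
  have hf : ∀ a, Finite (prefixes m (residualSet [a] X)) := fun a => finite_prefixes m _
  let f : (Σ a, prefixes m (residualSet [a] X)) → prefixes (m + 1) X := fun t =>
    ⟨t.1 :: t.2.1, by simpa using t.2.2.1, by rw [residualSet_cons]; exact t.2.2.2⟩
  have hb : Function.Bijective f := by
    constructor
    · rintro ⟨a, u, hu⟩ ⟨b, v, hv⟩ h
      have h' := congrArg Subtype.val h
      simp only [f, List.cons.injEq] at h'
      obtain ⟨rfl, rfl⟩ := h'
      rfl
    · rintro ⟨u, hu, hn⟩
      obtain ⟨a, v, rfl⟩ := List.exists_cons_of_length_eq_add_one hu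
      refine ⟨⟨a, v, by simpa using hu, ?_⟩, rfl⟩
      rwa [← residualSet_cons]
  have h := Nat.card_congr (Equiv.ofBijective f hb)
  rw [Nat.card_sigma] at h
  exact h.symm

theorem toZModPow_eq_iff (m : ℕ) (x y : ℤ_[p]) :
    PadicInt.toZModPow m x = PadicInt.toZModPow m y ↔ (p : ℤ_[p]) ^ m ∣ x - y := by
  rw [← sub_eq_zero, ← map_sub, ← RingHom.mem_ker, PadicInt.ker_toZModPow,
    Ideal.mem_span_singleton]

/-- Words of length m correspond to residues modulo p^m; counting residues makes affine images and
unions easy to estimate. -/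
theorem prefixCount_eq_ncard (m : ℕ) (X : Set ℤ_[p]) :
    prefixCount m X = (PadicInt.toZModPow m '' X).ncard := by
  have e : PadicInt.toZModPow m '' X =
      (fun u => PadicInt.toZModPow m (digitsVal u : ℤ_[p])) '' prefixes m X := by
    ext z
    constructor
    · rintro ⟨x, hx, rfl⟩
      obtain ⟨u, hu, e⟩ := exists_digitsVal_eq m (x.appr_lt m)
      have hd : (p : ℤ_[p]) ^ m ∣ x - digitsVal u := by
        rw [e, ← Ideal.mem_span_singleton]; exact x.appr_spec m
      exact ⟨u, ⟨hu, (residualSet_nonempty_iff u X).2 ⟨x, hx, hu ▸ hd⟩⟩,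
        ((toZModPow_eq_iff m _ _).2 hd).symm⟩
    · rintro ⟨u, ⟨hu, hn⟩, rfl⟩
      obtain ⟨x, hx, hd⟩ := (residualSet_nonempty_iff u X).1 hn
      exact ⟨x, hx, (toZModPow_eq_iff m _ _).2 (hu ▸ hd)⟩
  rw [e, prefixCount, Set.InjOn.ncard_image]
  rintro u ⟨hu, -⟩ v ⟨hv, -⟩ h
  refine digitsVal_inj (hu.trans hv.symm) ?_
  exact natCast_eq_of_pow_dvd_sub (hu ▸ digitsVal_lt u) (hv ▸ digitsVal_lt v) (by simp)
    ((toZModPow_eq_iff m _ _).1 h)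

theorem prefixCount_le_pow (m : ℕ) (X : Set ℤ_[p]) : prefixCount m X ≤ p ^ m := by
  have : NeZero (p ^ m) := ⟨by have := PadicIFS.one_lt_p (p := p); positivity⟩
  rw [prefixCount_eq_ncard]
  refine (Set.ncard_le_ncard (Set.subset_univ _)).trans_eq ?_
  rw [Set.ncard_univ, Nat.card_zmod]

theorem prefixCount_pos (m : ℕ) {X : Set ℤ_[p]} (h : X.Nonempty) : 0 < prefixCount m X := by
  have : NeZero (p ^ m) := ⟨by have := PadicIFS.one_lt_p (p := p); positivity⟩
  rw [prefixCount_eq_ncard, Set.ncard_pos]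
  exact h.image _

end Residuals

/-! ### Finitely many residuals -/

namespace PadicIFS

variable {p : ℕ} [Fact p.Prime]

/-- The sum of the exponents of the system. -/
def kSum (F : PadicIFS p) : ℕ := ∑ i, F.k i

theorem k_le_kSum (F : PadicIFS p) (i : Fin F.n) : F.k i ≤ F.kSum :=
  Finset.single_le_sum (f := F.k) (fun _ _ => Nat.zero_le _) (Finset.mem_univ i)

theorem kap_append (F : PadicIFS p) (l l' : List (Fin F.n)) :
    F.kap (l ++ l') = F.kap l + F.kap l' := by simp [kap]

theorem comp_append (F : PadicIFS p) (l l' : List (Fin F.n)) (x : ℤ_[p]) :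
    F.comp (l ++ l') x = F.comp l (F.comp l' x) := by simp [comp]

/-- An address of x is cut when its exponent first reaches m; the overshoot is at most one k_i,
hence at most their sum. -/
theorem exists_comp_eq (F : PadicIFS p) {x : ℤ_[p]} (hx : x ∈ Set.range F.point) (m : ℕ) :
    ∃ (l : List (Fin F.n)), ∃ z ∈ Set.range F.point,
      F.comp l z = x ∧ m ≤ F.kap l ∧ F.kap l ≤ m + F.kSum := by
  induction m with
  | zero => exact ⟨[], x, hx, rfl, by simp, by simp⟩
  | succ m ih =>
    obtain ⟨l, z, ⟨a, rfl⟩, e, h1, h2⟩ := ih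
    by_cases h : m + 1 ≤ F.kap l
    · exact ⟨l, _, ⟨a, rfl⟩, e, h, by omega⟩
    · refine ⟨l ++ [a 0], _, ⟨fun i => a (i + 1), rfl⟩, ?_, ?_⟩
      · rw [comp_append, ← e, F.point_eq a]
        rfl
      · have h3 := F.one_le_k (a 0)
        have h4 := F.k_le_kSum (a 0)
        rw [kap_append]
        simp only [kap_cons, kap_nil]
        omega

/-- A bound for the carries of the residuals, over the common denominator. -/
def carryBound (F : PadicIFS p) : ℕ := F.numBound * p ^ F.kSum + F.den

/-- The parameters (carry, sign, exponent) of the pieces of the residuals. -/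
noncomputable def pieceParams (F : PadicIFS p) : Finset (ℤ × ℤˣ × ℕ) :=
  Finset.Icc (-(F.carryBound : ℤ)) F.carryBound ×ˢ Finset.univ ×ˢ Finset.range (F.kSum + 1)

/-- The set `c / D + ε * p ^ j * K`, where `D` is the common denominator. -/
def piece (F : PadicIFS p) (t : ℤ × ℤˣ × ℕ) : Set ℤ_[p] :=
  {y | ∃ z ∈ Set.range F.point,
    (F.den : ℤ_[p]) * y = F.den * ((t.2.1 : ℤ) : ℤ_[p]) * (p : ℤ_[p]) ^ t.2.2 * z + t.1}

/-- The number of parameters of pieces. -/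
def pieceCount (F : PadicIFS p) : ℕ := (2 * F.carryBound + 1) * (2 * (F.kSum + 1))

theorem card_pieceParams (F : PadicIFS p) : F.pieceParams.card = F.pieceCount := by
  simp only [pieceParams, Finset.card_product, Int.card_Icc, Finset.card_univ,
    Fintype.card_units_int, Finset.card_range, pieceCount]
  congr 1
  omega

theorem den_ne_zero (F : PadicIFS p) : (F.den : ℤ_[p]) ≠ 0 := F.isUnit_den.ne_zero

/-- The word l cut from an address at exponent at least |u| sends all of K into one class modulo
p^|u|, the class of u. Removing u and dividing by p^|u| turns the image of K into a piece, whose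
carry is bounded because the translation part of l is at most a constant times p^κ(l). -/
theorem exists_piece (F : PadicIFS p) (u : List (Fin p)) {y : ℤ_[p]}
    (hy : y ∈ residualSet u (Set.range F.point)) :
    ∃ t ∈ F.pieceParams, y ∈ F.piece t ∧ F.piece t ⊆ residualSet u (Set.range F.point) := by
  obtain ⟨l, z, hz, e, h1, h2⟩ := F.exists_comp_eq hy u.length
  obtain ⟨j, hj⟩ := Nat.exists_eq_add_of_le h1
  have hp0 : (p : ℤ_[p]) ^ u.length ≠ 0 :=
    pow_ne_zero _ (by exact_mod_cast (Fact.out : p.Prime).ne_zero)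
  have hcomp : ∀ z, (F.den : ℤ_[p]) * F.comp l z = F.den * ((F.sgn l : ℤ) : ℤ_[p]) *
      (p : ℤ_[p]) ^ u.length * (p : ℤ_[p]) ^ j * z + F.numComp l := fun z => by
    rw [F.comp_eq, mul_add, den_mul_comp, hj, pow_add]
    ring
  -- As p^|u| divides the linear coefficient, the translation part of l alone is congruent to u; the
  -- quotient c below is the carry of the piece.
  have hdvd : (p : ℤ) ^ u.length ∣ F.numComp l - F.den * digitsVal u := by
    rw [← PadicInt.pow_p_dvd_int_iff]
    refine ⟨F.den * y - F.den * ((F.sgn l : ℤ) : ℤ_[p]) * (p : ℤ_[p]) ^ j * z, ?_⟩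
    push_cast
    linear_combination F.den * e - hcomp z
  obtain ⟨c, hc⟩ := hdvd
  have hc' : (F.numComp l : ℤ_[p]) = F.den * digitsVal u + (p : ℤ_[p]) ^ u.length * c := by
    have := congrArg (fun x : ℤ => (x : ℤ_[p])) hc
    push_cast at this
    linear_combination this
  refine ⟨(c, F.sgn l, j), ?_, ⟨z, hz, ?_⟩, ?_⟩
  · simp only [pieceParams, Finset.mem_product, Finset.mem_Icc, Finset.mem_univ, Finset.mem_range,
      true_and]
    refine ⟨abs_le.1 ?_, by omega⟩
    have hpp : (1 : ℤ) ≤ p := by exact_mod_cast (one_lt_p (p := p)).le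
    have hpos : (0 : ℤ) < (p : ℤ) ^ u.length := by positivity
    refine le_of_mul_le_mul_left ?_ hpos
    have h3 := F.abs_numComp_le l
    have h4 : (p : ℤ) ^ F.kap l ≤ (p : ℤ) ^ (u.length + F.kSum) := by gcongr
    have h5 : (digitsVal u : ℤ) ≤ (p : ℤ) ^ u.length := by exact_mod_cast (digitsVal_lt u).le
    calc (p : ℤ) ^ u.length * |c| = |F.numComp l - F.den * digitsVal u| := by
          rw [hc, abs_mul, abs_of_pos hpos]
      _ ≤ |F.numComp l| + |(F.den : ℤ) * digitsVal u| := abs_sub _ _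
      _ ≤ F.numBound * (p : ℤ) ^ (u.length + F.kSum) + F.den * (p : ℤ) ^ u.length := by
          refine add_le_add (h3.trans ?_) ?_
          · gcongr
            linarith
          · rw [abs_of_nonneg (by positivity)]
            gcongr
      _ = (p : ℤ) ^ u.length * F.carryBound := by
          rw [carryBound]; push_cast; ring
  · refine mul_left_cancel₀ hp0 ?_
    change _ * (_ * y) = _ * (_ * ((F.sgn l : ℤ) : ℤ_[p]) * _ ^ j * z + c)
    linear_combination hcomp z - F.den * e + hc'
  · rintro y' ⟨z', hz', e'⟩
    have : (digitsVal u : ℤ_[p]) + (p : ℤ_[p]) ^ u.length * y' = F.comp l z' := by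
      refine mul_left_cancel₀ F.den_ne_zero ?_
      dsimp only at e'
      linear_combination (p : ℤ_[p]) ^ u.length * e' - hcomp z' - hc'
    rw [residualSet, Set.mem_ofPred_eq, this]
    exact F.comp_mem_range l hz'

/-- A residual is the union of all pieces contained in it, so it is determined by a subset of a
finite parameter set. -/
theorem finite_residuals (F : PadicIFS p) :
    {Y | ∃ u, Y = residualSet u (Set.range F.point)}.Finite := by
  refine ((F.pieceParams.powerset.finite_toSet).image fun T => ⋃ t ∈ T, F.piece t).subset ?_
  rintro _ ⟨u, rfl⟩
  classical
  refine ⟨F.pieceParams.filter fun t => F.piece t ⊆ residualSet u (Set.range F.point),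
    Finset.mem_coe.2 (Finset.mem_powerset.2 (Finset.filter_subset _ _)), ?_⟩
  ext y
  simp only [Finset.mem_filter, Set.mem_iUnion, exists_prop]
  constructor
  · rintro ⟨t, ⟨-, h⟩, hy⟩
    exact h hy
  · intro hy
    obtain ⟨t, ht, h1, h2⟩ := F.exists_piece u hy
    exact ⟨t, ⟨ht, h2⟩, h1⟩

/-- D is a unit, so modulo p^m a piece is an affine image of K. -/
theorem ncard_image_piece_le (F : PadicIFS p) (m : ℕ) (t : ℤ × ℤˣ × ℕ) :
    (PadicInt.toZModPow m '' F.piece t).ncard ≤ prefixCount m (Set.range F.point) := by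
  have : NeZero (p ^ m) := ⟨by have := PadicIFS.one_lt_p (p := p); positivity⟩
  obtain ⟨r, hr⟩ := F.isUnit_den.exists_left_inv
  rw [prefixCount_eq_ncard]
  let φ := PadicInt.toZModPow (p := p) m
  refine (Set.ncard_le_ncard (t := (fun z => φ r * (φ (F.den * ((t.2.1 : ℤ) : ℤ_[p]) *
    (p : ℤ_[p]) ^ t.2.2) * z + φ t.1)) '' (φ '' Set.range F.point)) ?_).trans
    (Set.ncard_image_le (Set.toFinite _))
  rintro _ ⟨y, ⟨z, hz, e⟩, rfl⟩
  refine ⟨φ z, ⟨z, hz, rfl⟩, ?_⟩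
  dsimp only
  rw [← map_mul, ← map_add, ← e, ← map_mul, ← mul_assoc, hr, one_mul]

theorem prefixCount_residual_le (F : PadicIFS p) (m : ℕ) (u : List (Fin p)) :
    prefixCount m (residualSet u (Set.range F.point)) ≤
      F.pieceCount * prefixCount m (Set.range F.point) := by
  have : NeZero (p ^ m) := ⟨by have := PadicIFS.one_lt_p (p := p); positivity⟩
  classical
  let f : ℤ × ℤˣ × ℕ → Finset (ZMod (p ^ m)) := fun t =>
    (Set.toFinite (PadicInt.toZModPow m '' F.piece t)).toFinset
  rw [prefixCount_eq_ncard, ← card_pieceParams]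
  calc _ ≤ ((F.pieceParams.biUnion f : Finset (ZMod (p ^ m))) : Set (ZMod (p ^ m))).ncard := by
        refine Set.ncard_le_ncard ?_
        rintro _ ⟨y, hy, rfl⟩
        obtain ⟨t, ht, h1, -⟩ := F.exists_piece u hy
        simp only [Finset.coe_biUnion, Set.mem_iUnion]
        exact ⟨t, ht, by simpa [f] using ⟨y, h1, rfl⟩⟩
    _ ≤ _ := by
        rw [Set.ncard_coe_finset]
        refine Finset.card_biUnion_le_card_mul _ _ _ fun t _ => ?_
        rw [← Set.ncard_eq_toFinset_card]
        exact F.ncard_image_piece_le m t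

end PadicIFS

/-! ### The automaton and its spectral radius -/

namespace PadicIFS

variable {p : ℕ} [Fact p.Prime]

/-- The states of the automaton: the non-empty residuals of the attractor. -/
def State (F : PadicIFS p) : Type :=
  {Y : Set ℤ_[p] // Y.Nonempty ∧ ∃ u, Y = residualSet u (Set.range F.point)}

instance (F : PadicIFS p) : Finite F.State :=
  (F.finite_residuals.subset fun _ h => h.2).to_subtype

noncomputable instance (F : PadicIFS p) : Fintype F.State := Fintype.ofFinite _

noncomputable instance (F : PadicIFS p) : DecidableEq F.State := Classical.decEq _

theorem range_point_nonempty (F : PadicIFS p) : (Set.range F.point).Nonempty :=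
  ⟨_, ⟨fun _ => ⟨0, F.n_pos⟩, rfl⟩⟩

/-- The initial state: the attractor. -/
def initState (F : PadicIFS p) : F.State :=
  ⟨Set.range F.point, F.range_point_nonempty, [], by simp⟩

/-- The minimal automaton of the expansions of the points of the attractor. -/
def automaton (F : PadicIFS p) : NFA (Fin p) F.State where
  step Y a := {Z | Z.1 = residualSet [a] Y.1}
  start := {F.initState}
  accept := Set.univ

theorem automaton_isPathAutomaton (F : PadicIFS p) : F.automaton.IsPathAutomaton :=
  ⟨⟨_, rfl⟩, rfl⟩

theorem automaton_isDeterministic (F : PadicIFS p) : F.automaton.IsDeterministic :=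
  fun _ _ _ h _ h' => Subtype.ext (Eq.trans h (Eq.symm h'))

theorem mem_eval_automaton (F : PadicIFS p) (u : List (Fin p)) (Z : F.State) :
    Z ∈ F.automaton.eval u ↔ Z.1 = residualSet u (Set.range F.point) := by
  induction u using List.reverseRecOn generalizing Z with
  | nil =>
    rw [NFA.eval_nil, residualSet_nil]
    exact ⟨fun h => congrArg Subtype.val h, fun h => Subtype.ext h⟩
  | append_singleton u a ih =>
    rw [NFA.eval_append_singleton, NFA.mem_stepSet, residualSet_append]
    constructor
    · rintro ⟨Y, hY, h⟩
      rw [ih] at hY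
      rw [← hY]
      exact h
    · intro h
      have hne : (residualSet u (Set.range F.point)).Nonempty :=
        Set.Nonempty.of_residual (u := [a]) (h ▸ Z.2.1)
      exact ⟨⟨_, hne, u, rfl⟩, (ih _).2 rfl, h⟩

theorem mem_accepts_automaton (F : PadicIFS p) (u : List (Fin p)) :
    u ∈ F.automaton.accepts ↔ (residualSet u (Set.range F.point)).Nonempty := by
  constructor
  · rintro ⟨Z, -, hZ⟩
    rw [mem_eval_automaton] at hZ
    exact hZ ▸ Z.2.1
  · intro h
    exact ⟨⟨_, h, u, rfl⟩, Set.mem_univ _, (F.mem_eval_automaton u _).2 rfl⟩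

/-- If each prefix begins a point of K, these points converge to the value of w, and closedness puts
it in K. -/
theorem mem_infiniteWords_automaton (F : PadicIFS p) (hc : IsClosed (Set.range F.point))
    (w : ℕ → Fin p) : w ∈ F.automaton.infiniteWords ↔ wordVal w ∈ Set.range F.point := by
  have h : w ∈ F.automaton.infiniteWords ↔
      ∀ m, (residualSet (wordPrefix w m) (Set.range F.point)).Nonempty :=
    forall_congr' fun m => F.mem_accepts_automaton _
  simp only [h, residualSet_nonempty_iff, length_wordPrefix]
  constructor
  · intro h
    choose x hx hd using h
    refine hc.mem_of_tendsto (b := Filter.atTop) (f := x) ?_ (Filter.Eventually.of_forall hx)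
    rw [tendsto_iff_norm_sub_tendsto_zero]
    refine squeeze_zero (fun _ => norm_nonneg _) (fun m => ?_) (tendsto_inv_p_pow_mul (p := p) 1)
    rw [mul_one, ← PadicInt.pow_p_dvd_iff_norm_le]
    simpa using dvd_sub (hd m) (pow_dvd_wordVal_sub w m)
  · exact fun h m => ⟨_, h, pow_dvd_wordVal_sub w m⟩

/-- The adjacency matrix with natural number entries. -/
noncomputable def natAdjacency (F : PadicIFS p) : Matrix F.State F.State ℕ :=
  fun q q' => Set.ncard {a | q' ∈ F.automaton.step q a}

theorem adjacency_eq (F : PadicIFS p) :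
    F.automaton.adjacency = (Nat.castRingHom ℂ).mapMatrix F.natAdjacency := rfl

/-- Sorting prefixes by first letter; a letter with empty residual has no transition and also
contributes no prefix. -/
theorem natAdjacency_mulVec (F : PadicIFS p) (m : ℕ) :
    (F.natAdjacency.mulVec fun Z => prefixCount m Z.1) = fun Z => prefixCount (m + 1) Z.1 := by
  classical
  ext Y
  rw [prefixCount_succ]
  have h1 : ∀ Z, F.natAdjacency Y Z * prefixCount m Z.1 =
      ∑ a, if Z.1 = residualSet [a] Y.1 then prefixCount m (residualSet [a] Y.1) else 0 := by
    intro Z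
    have : F.natAdjacency Y Z =
        (Finset.univ.filter fun a => Z.1 = residualSet [a] Y.1).card := by
      rw [← Set.ncard_coe_finset]
      simp [natAdjacency, automaton]
    rw [this, ← Finset.sum_filter, Finset.card_eq_sum_ones, Finset.sum_mul]
    refine Finset.sum_congr rfl fun a ha => ?_
    rw [one_mul, (Finset.mem_filter.1 ha).2]
  simp only [Matrix.mulVec, dotProduct, h1]
  rw [Finset.sum_comm]
  refine Finset.sum_congr rfl fun a _ => ?_
  by_cases h : (residualSet [a] Y.1).Nonempty
  · obtain ⟨u, hu⟩ := Y.2.2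
    let Z : F.State := ⟨residualSet [a] Y.1, h, u ++ [a], by rw [residualSet_append, ← hu]⟩
    rw [Finset.sum_eq_single Z]
    · simp [Z]
    · intro Z' _ hZ'
      exact if_neg fun e => hZ' (Subtype.ext e)
    · simp
  · have h0 : prefixCount m (residualSet [a] Y.1) = 0 := by
      rw [prefixCount_eq_ncard, Set.not_nonempty_iff_eq_empty.1 h]
      simp
    simp [h0]

theorem sum_natAdjacency_pow (F : PadicIFS p) (m : ℕ) (Y : F.State) :
    ∑ Z, (F.natAdjacency ^ m) Y Z = prefixCount m Y.1 := by
  have h : ((F.natAdjacency ^ m).mulVec fun Z => prefixCount 0 Z.1) =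
      fun Z => prefixCount m Z.1 := by
    induction m with
    | zero => simp
    | succ m ih => rw [pow_succ', ← Matrix.mulVec_mulVec, ih, natAdjacency_mulVec]
  have := congrFun h Y
  simp only [Matrix.mulVec, dotProduct] at this
  rw [← this]
  refine Finset.sum_congr rfl fun Z _ => ?_
  rw [prefixCount_zero Z.2.1, mul_one]

section Spectral

open Matrix

attribute [local instance] Matrix.linftyOpNormedRing Matrix.linftyOpNormedAlgebra

/-- The number of words of length `m` that begin an expansion of a point of the attractor. -/
noncomputable def count (F : PadicIFS p) (m : ℕ) : ℕ := prefixCount m F.initState.1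

/-- The ℓ^∞ operator norm is the largest row sum, and the row sums of A^m are prefix counts. -/
theorem nnnorm_adjacency_pow (F : PadicIFS p) (m : ℕ) :
    ‖F.automaton.adjacency ^ m‖₊ =
      (Finset.univ : Finset F.State).sup fun Y => (prefixCount m Y.1 : NNReal) := by
  rw [adjacency_eq, ← map_pow, Matrix.linfty_opNNNorm_def]
  refine Finset.sup_congr rfl fun Y _ => ?_
  rw [← sum_natAdjacency_pow]
  push_cast
  refine Finset.sum_congr rfl fun Z _ => ?_
  simp

theorem count_le_nnnorm (F : PadicIFS p) (m : ℕ) :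
    (F.count m : NNReal) ≤ ‖F.automaton.adjacency ^ m‖₊ := by
  rw [nnnorm_adjacency_pow]
  have h := Finset.le_sup (f := fun Y : F.State => (prefixCount m Y.1 : NNReal))
    (Finset.mem_univ F.initState)
  rw [count]
  exact h

theorem nnnorm_le_mul_count (F : PadicIFS p) (m : ℕ) :
    ‖F.automaton.adjacency ^ m‖₊ ≤ F.pieceCount * F.count m := by
  rw [nnnorm_adjacency_pow]
  refine Finset.sup_le fun Y _ => ?_
  obtain ⟨u, hu⟩ := Y.2.2
  rw [hu]
  exact_mod_cast F.prefixCount_residual_le m u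

/-- The spectral radius of the adjacency matrix, as a real number. -/
noncomputable def spectralValue (F : PadicIFS p) : ℝ :=
  (spectralRadius ℂ F.automaton.adjacency).toReal

instance (F : PadicIFS p) : Nonempty F.State := ⟨F.initState⟩

theorem spectralRadius_ne_top (F : PadicIFS p) :
    spectralRadius ℂ F.automaton.adjacency ≠ ⊤ :=
  ((spectrum.spectralRadius_le_nnnorm (𝕜 := ℂ) F.automaton.adjacency).trans_lt
    ENNReal.coe_lt_top).ne

/-- Gelfand's formula, applied to the norms that dominate the counts. -/
theorem eventually_count_le (F : PadicIFS p) {r : ℝ} (hr : F.spectralValue < r) :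
    ∀ᶠ m in Filter.atTop, (F.count m : ℝ) ≤ r ^ m := by
  have : CompleteSpace (Matrix F.State F.State ℂ) := FiniteDimensional.complete ℂ _
  have h := spectrum.pow_nnnorm_pow_one_div_tendsto_nhds_spectralRadius F.automaton.adjacency
  have hr0 : 0 < r := ENNReal.toReal_nonneg.trans_lt hr
  have hlt : spectralRadius ℂ F.automaton.adjacency < ENNReal.ofReal r :=
    (ENNReal.lt_ofReal_iff_toReal_lt F.spectralRadius_ne_top).2 hr
  filter_upwards [h.eventually (gt_mem_nhds hlt), Filter.eventually_gt_atTop 0] with m hm hm0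
  have h1 := ENNReal.rpow_le_rpow hm.le (by positivity : (0 : ℝ) ≤ m)
  rw [← ENNReal.rpow_mul, one_div_mul_cancel (by positivity), ENNReal.rpow_one,
    ENNReal.rpow_natCast, ← ENNReal.ofReal_pow hr0.le] at h1
  have h2 : ((F.count m : NNReal) : ENNReal) ≤ ENNReal.ofReal (r ^ m) :=
    (ENNReal.coe_le_coe.2 (F.count_le_nnnorm m)).trans h1
  have h3 := ENNReal.toReal_mono ENNReal.ofReal_ne_top h2
  rw [ENNReal.toReal_ofReal (by positivity)] at h3
  simpa using h3

/-- This direction holds for every m, with explicit constant, since ρ(A)^m ≤ ρ(A^m) ≤ ‖A^m‖; the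
algorithm depends on that. -/
theorem spectralValue_pow_le (F : PadicIFS p) (m : ℕ) :
    F.spectralValue ^ m ≤ F.pieceCount * F.count m := by
  have h1 : spectralRadius ℂ F.automaton.adjacency ^ m ≤
      spectralRadius ℂ (F.automaton.adjacency ^ m) := by
    rcases Nat.eq_zero_or_pos m with rfl | hm
    · have : CompleteSpace (Matrix F.State F.State ℂ) := FiniteDimensional.complete ℂ _
      simp
    · exact spectrum.spectralRadius_pow_le _ _ hm.ne'
  have h2 := h1.trans (spectrum.spectralRadius_le_nnnorm _)
  have h3 := h2.trans (ENNReal.coe_le_coe.2 (F.nnnorm_le_mul_count m))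
  have h4 := ENNReal.toReal_mono ENNReal.coe_ne_top h3
  simpa [spectralValue] using h4

end Spectral

theorem count_pos (F : PadicIFS p) (m : ℕ) : 0 < F.count m :=
  prefixCount_pos m F.range_point_nonempty

theorem one_le_spectralValue (F : PadicIFS p) : 1 ≤ F.spectralValue := by
  by_contra! h
  obtain ⟨r, h1, h2⟩ := exists_between h
  have hr0 : 0 ≤ r := ENNReal.toReal_nonneg.trans h1.le
  obtain ⟨m, hm, hm0⟩ := ((F.eventually_count_le h1).and (Filter.eventually_gt_atTop 0)).exists
  have h3 : (1 : ℝ) ≤ F.count m := by exact_mod_cast F.count_pos m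
  exact (h3.trans hm).not_gt (pow_lt_one₀ hr0 h2 hm0.ne')

end PadicIFS

/-! ### Upper bound for the dimension -/

open MeasureTheory in
-- The cylinders of length m cover X by at most r^m sets of diameter at most p^(-m), and r^m p^(-md)
-- → 0, so the d-dimensional measure vanishes.
theorem dimH_le_of_eventually_prefixCount_le {p : ℕ} [Fact p.Prime] {X : Set ℤ_[p]} {r : ℝ}
    {d : NNReal} (hr : r < (p : ℝ) ^ (d : ℝ)) (hr0 : 0 ≤ r)
    (h : ∀ᶠ m in Filter.atTop, (prefixCount m X : ℝ) ≤ r ^ m) : dimH X ≤ d := by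
  borelize ℤ_[p]
  have hp0 : (0 : ℝ) < p := by exact_mod_cast (Fact.out : p.Prime).pos
  refine dimH_le_of_hausdorffMeasure_ne_top ?_
  suffices h0 : Measure.hausdorffMeasure (d : ℝ) X ≤ 0 from (h0.trans_lt ENNReal.zero_lt_top).ne
  let t : ∀ m : ℕ, prefixes m X → Set ℤ_[p] := fun m u =>
    {x | (p : ℤ_[p]) ^ m ∣ x - digitsVal u.1}
  let ρ : ℕ → ENNReal := fun m => ENNReal.ofReal (((p : ℝ)⁻¹) ^ m)
  have ht : ∀ m i, Metric.ediam (t m i) ≤ ρ m := fun m i => by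
    refine Metric.ediam_le fun x hx y hy => ?_
    rw [edist_dist, dist_eq_norm]
    refine ENNReal.ofReal_le_ofReal ?_
    rw [← PadicInt.pow_p_dvd_iff_norm_le]
    have hx' : (p : ℤ_[p]) ^ m ∣ x - digitsVal i.1 := hx
    have hy' : (p : ℤ_[p]) ^ m ∣ y - digitsVal i.1 := hy
    simpa using dvd_sub hx' hy'
  have hf : ∀ m, Fintype (prefixes m X) := fun m => (finite_prefixes m X).fintype
  refine (Measure.hausdorffMeasure_le_liminf_sum (ι := fun m => prefixes m X) (d : ℝ) X
    (l := Filter.atTop) ρ ?_ t (Filter.Eventually.of_forall ht)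
    (Filter.Eventually.of_forall fun m x hx => ?_)).trans ?_
  · rw [← ENNReal.ofReal_zero]
    refine ENNReal.tendsto_ofReal ?_
    exact tendsto_pow_atTop_nhds_zero_of_lt_one PadicIFS.inv_p_pos.le PadicIFS.inv_p_lt_one
  · obtain ⟨u, hu, e⟩ := exists_digitsVal_eq m (x.appr_lt m)
    have hd : (p : ℤ_[p]) ^ m ∣ x - digitsVal u := by
      rw [e, ← Ideal.mem_span_singleton]; exact x.appr_spec m
    exact Set.mem_iUnion.2 ⟨⟨u, hu, (residualSet_nonempty_iff u X).2 ⟨x, hx, hu ▸ hd⟩⟩, hd⟩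
  · have hq : r * ((p : ℝ) ^ (d : ℝ))⁻¹ < 1 := by
      rw [← div_eq_mul_inv, div_lt_one (by positivity)]
      exact hr
    have h1 : Filter.Tendsto (fun m : ℕ => ENNReal.ofReal ((r * ((p : ℝ) ^ (d : ℝ))⁻¹) ^ m))
        Filter.atTop (nhds 0) := by
      rw [← ENNReal.ofReal_zero]
      exact ENNReal.tendsto_ofReal (tendsto_pow_atTop_nhds_zero_of_lt_one (by positivity) hq)
    rw [← h1.liminf_eq]
    refine Filter.liminf_le_liminf ?_
    filter_upwards [h] with m hm
    calc ∑ i, Metric.ediam (t m i) ^ (d : ℝ) ≤ ∑ _i : prefixes m X, ρ m ^ (d : ℝ) :=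
          Finset.sum_le_sum fun i _ => ENNReal.rpow_le_rpow (ht m i) d.coe_nonneg
      _ = ENNReal.ofReal (prefixCount m X) * ρ m ^ (d : ℝ) := by
          rw [Finset.sum_const, Finset.card_univ, nsmul_eq_mul, ENNReal.ofReal_natCast,
            prefixCount, Set.ncard_eq_toFinset_card', Set.toFinset_card]
      _ ≤ ENNReal.ofReal (r ^ m) * ENNReal.ofReal ((((p : ℝ)⁻¹) ^ m) ^ (d : ℝ)) := by
          rw [ENNReal.ofReal_rpow_of_nonneg (by positivity) d.coe_nonneg]
          gcongr
      _ = _ := by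
          rw [← ENNReal.ofReal_mul (by positivity), mul_pow]
          congr 2
          rw [← Real.rpow_natCast, ← Real.rpow_mul (by positivity), mul_comm (m : ℝ),
            Real.rpow_mul (by positivity), Real.rpow_natCast, Real.inv_rpow hp0.le]

namespace PadicIFS

variable {p : ℕ} [Fact p.Prime]

theorem log_p_pos : 0 < Real.log p := Real.log_pos (by exact_mod_cast one_lt_p (p := p))

/-- The logarithm to base `p` of the spectral radius of the adjacency matrix. -/
noncomputable def dimValue (F : PadicIFS p) : ℝ := Real.log F.spectralValue / Real.log p

theorem dimValue_nonneg (F : PadicIFS p) : 0 ≤ F.dimValue :=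
  div_nonneg (Real.log_nonneg F.one_le_spectralValue) log_p_pos.le

theorem dimH_range_point_le (F : PadicIFS p) :
    dimH (Set.range F.point) ≤ ENNReal.ofReal F.dimValue := by
  refine ENNReal.le_of_forall_pos_le_add fun ε hε _ => ?_
  let d : NNReal := Real.toNNReal F.dimValue + ε
  have hd : (d : ℝ) = F.dimValue + ε := by
    simp [d, Real.coe_toNNReal _ F.dimValue_nonneg]
  have hp0 : (0 : ℝ) < p := by exact_mod_cast (Fact.out : p.Prime).pos
  have hl : F.spectralValue < (p : ℝ) ^ (d : ℝ) := by
    have h1 := F.one_le_spectralValue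
    rw [← Real.log_lt_log_iff (by linarith) (by positivity), Real.log_rpow hp0, hd]
    have : Real.log F.spectralValue = F.dimValue * Real.log p := by
      rw [dimValue, div_mul_cancel₀ _ log_p_pos.ne']
    rw [this]
    have hε' : (0 : ℝ) < ε := hε
    have := log_p_pos (p := p)
    nlinarith
  obtain ⟨r, h1, h2⟩ := exists_between hl
  have h3 := dimH_le_of_eventually_prefixCount_le h2
    (zero_le_one.trans (F.one_le_spectralValue.trans h1.le)) (F.eventually_count_le h1)
  refine h3.trans_eq ?_
  simp only [d, ENNReal.coe_add]
  rfl

/-! ### Lower bound by separated subsystems -/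

theorem norm_mapInt_sub (F : PadicIFS p) (i : Fin F.n) (x y : ℤ_[p]) :
    ‖F.mapInt i x - F.mapInt i y‖ = ((p : ℝ)⁻¹) ^ F.k i * ‖x - y‖ := by
  have h := F.norm_map_sub i x y
  rw [← coe_mapInt, ← coe_mapInt] at h
  exact h

/-- The pieces of the attractor under different maps have distance at least `p ^ (-M)`. -/
def IsSeparated (F : PadicIFS p) (M : ℕ) : Prop :=
  ∀ i j, i ≠ j → ∀ x ∈ Set.range F.point, ∀ y ∈ Set.range F.point,
    ((p : ℝ)⁻¹) ^ M ≤ ‖F.mapInt i x - F.mapInt j y‖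

/-- Each common first letter shrinks the distance by p^(-k) ≥ p^(-M), and the first difference
contributes the separation p^(-M). -/
theorem IsSeparated.le_norm_point_sub {F : PadicIFS p} {M : ℕ} (h : F.IsSeparated M)
    (hk : ∀ i, F.k i ≤ M) (n : ℕ) {a b : ℕ → Fin F.n} (hab : ∀ i < n, a i = b i)
    (hn : a n ≠ b n) : ((p : ℝ)⁻¹) ^ (M * (n + 1)) ≤ ‖F.point a - F.point b‖ := by
  induction n generalizing a b with
  | zero =>
    rw [F.point_eq a, F.point_eq b]
    simpa using h _ _ hn _ ⟨_, rfl⟩ _ ⟨_, rfl⟩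
  | succ n ih =>
    rw [F.point_eq a, F.point_eq b, ← hab 0 (Nat.succ_pos n), norm_mapInt_sub,
      Nat.mul_succ, pow_add]
    have := inv_p_pos (p := p)
    refine (mul_comm _ _).trans_le (mul_le_mul
      (pow_le_pow_of_le_one inv_p_pos.le inv_p_lt_one.le (hk _))
      (ih (fun i hi => hab (i + 1) (by omega)) hn) (by positivity) (by positivity))

theorem IsSeparated.point_injective {F : PadicIFS p} {M : ℕ} (h : F.IsSeparated M)
    (hk : ∀ i, F.k i ≤ M) : Function.Injective F.point := by
  classical
  intro a b hab
  by_contra hne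
  have hex : ∃ n, a n ≠ b n := Function.ne_iff.1 hne
  have := h.le_norm_point_sub hk (Nat.find hex)
    (fun i hi => not_not.1 (Nat.find_min hex hi)) (Nat.find_spec hex)
  rw [hab, sub_self, norm_zero] at this
  exact this.not_gt (pow_pos inv_p_pos _)

/-- Reading the address of a point as a base n expansion maps the point set onto [0,1]. By
separation this map is Hölder of exponent s = log n / (M log p), and [0,1] has dimension 1. -/
theorem IsSeparated.le_dimH {F : PadicIFS p} {M : ℕ} (h : F.IsSeparated M)
    (hk : ∀ i, F.k i ≤ M) (hn : 1 < F.n) :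
    ENNReal.ofReal (Real.log F.n / (M * Real.log p)) ≤ dimH (Set.range F.point) := by
  classical
  have hM : 0 < M := lt_of_lt_of_le (F.one_le_k ⟨0, F.n_pos⟩) (hk _)
  have hlp := log_p_pos (p := p)
  have hln : 0 < Real.log F.n := Real.log_pos (by exact_mod_cast hn)
  have hp0 : (0 : ℝ) < p := by exact_mod_cast (Fact.out : p.Prime).pos
  have hn0 : (0 : ℝ) < F.n := by exact_mod_cast F.n_pos
  let s : NNReal := ⟨Real.log F.n / (M * Real.log p), by positivity⟩
  have hs : (s : ℝ) = Real.log F.n / (M * Real.log p) := rfl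
  have hs0 : 0 < s := by
    rw [← NNReal.coe_pos, hs]; positivity
  -- The exponent s is chosen so that p^(-Ms) = 1/n; the index shift between h1 and h2 costs the
  -- Hölder constant n.
  have hpow : ∀ k : ℕ, (((p : ℝ)⁻¹) ^ (M * k)) ^ (s : ℝ) = ((F.n : ℝ) ^ k)⁻¹ := fun k => by
    refine Real.log_injOn_pos (Set.mem_Ioi.2 (by positivity)) (Set.mem_Ioi.2 (by positivity)) ?_
    rw [Real.log_rpow (by positivity), Real.log_pow, Real.log_inv, Real.log_inv, Real.log_pow, hs]
    push_cast
    field_simp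
  have : Nonempty (ℕ → Fin F.n) := ⟨fun _ => ⟨0, F.n_pos⟩⟩
  let f : ℤ_[p] → ℝ := fun x => Real.ofDigits (Function.invFun F.point x)
  have hf : ∀ a, f (F.point a) = Real.ofDigits a := fun a => by
    simp only [f, Function.leftInverse_invFun (h.point_injective hk) a]
  have hh : HolderOnWith F.n s f (Set.range F.point) := by
    rintro _ ⟨a, rfl⟩ _ ⟨b, rfl⟩
    rw [hf, hf]
    by_cases hab : a = b
    · simp [hab]
    have hex : ∃ n, a n ≠ b n := Function.ne_iff.1 hab
    have heq : ∀ i < Nat.find hex, a i = b i := fun i hi => not_not.1 (Nat.find_min hex hi)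
    have h1 := h.le_norm_point_sub hk (Nat.find hex) heq (Nat.find_spec hex)
    have h2 := Real.abs_ofDigits_sub_ofDigits_le heq
    have h3 := Real.rpow_le_rpow (by positivity) h1 s.coe_nonneg
    rw [hpow] at h3
    rw [edist_dist, edist_dist, ENNReal.ofReal_rpow_of_nonneg dist_nonneg s.coe_nonneg,
      ← ENNReal.ofReal_coe_nnreal, ← ENNReal.ofReal_mul (NNReal.coe_nonneg _), Real.dist_eq,
      dist_eq_norm]
    refine ENNReal.ofReal_le_ofReal (h2.trans ?_)
    refine le_trans ?_ (mul_le_mul_of_nonneg_left h3 (NNReal.coe_nonneg _))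
    rw [pow_succ, mul_inv, NNReal.coe_natCast, mul_comm (F.n : ℝ), inv_mul_cancel_right₀ hn0.ne']
  have h1 : (1 : ENNReal) ≤ dimH (f '' Set.range F.point) := by
    have h2 : Set.Icc (0 : ℝ) 1 ⊆ f '' Set.range F.point := fun x hx => by
      obtain ⟨a, -, ha⟩ := Real.ofDigits_SurjOn hn hx
      exact ⟨_, ⟨a, rfl⟩, (hf a).trans ha⟩
    refine le_trans ?_ (dimH_mono h2)
    rw [Real.dimH_of_nonempty_interior (by simp)]
    simp
  have h2 := h1.trans (hh.dimH_image_le hs0)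
  rw [ENNReal.le_div_iff_mul_le (Or.inl (by simpa using hs0.ne')) (Or.inl ENNReal.coe_ne_top),
    one_mul] at h2
  refine le_trans (le_of_eq ?_) h2
  exact ENNReal.ofReal_eq_coe_nnreal _

/-- The iterated function system whose maps are compositions of maps of a given one. -/
noncomputable def compose (F : PadicIFS p) {N : ℕ} (hN : 0 < N) (l : Fin N → List (Fin F.n))
    (hl : ∀ i, 1 ≤ F.kap (l i)) : PadicIFS p where
  n := N
  n_pos := hN
  b i := if F.sgn (l i) = 1 then 0 else 1
  k i := F.kap (l i)
  one_le_k := hl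
  d i := (F.numComp (l i) : ℚ) / F.den
  d_mem i := by
    push_cast
    rw [norm_div, F.norm_den, div_one]
    exact Padic.norm_int_le_one _

theorem mapInt_compose (F : PadicIFS p) {N : ℕ} (hN : 0 < N) (l : Fin N → List (Fin F.n))
    (hl : ∀ i, 1 ≤ F.kap (l i)) (i : Fin N) (x : ℤ_[p]) :
    (F.compose hN l hl).mapInt i x = F.comp (l i) x := by
  have h1 : (F.den : ℤ_[p]) * (F.compose hN l hl).dInt i = F.numComp (l i) := by
    apply PadicInt.ext
    have h : (F.den : ℚ) * (F.compose hN l hl).d i = F.numComp (l i) := by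
      have : (F.den : ℚ) ≠ 0 := by exact_mod_cast F.den_pos.ne'
      simp only [compose]
      field_simp
    have := congrArg (fun q : ℚ => (q : ℚ_[p])) h
    rw [PadicInt.coe_mul]
    push_cast at this ⊢
    exact this
  have h2 : (F.compose hN l hl).dInt i = F.comp (l i) 0 :=
    mul_left_cancel₀ F.den_ne_zero (h1.trans (F.den_mul_comp (l i)).symm)
  rw [F.comp_eq (l i) x, ← h2]
  change (-1) ^ ((if F.sgn (l i) = 1 then 0 else 1 : Fin 2) : ℕ) * (p : ℤ_[p]) ^ F.kap (l i) * x +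
    _ = _
  congr 3
  rcases Int.units_eq_one_or (F.sgn (l i)) with h | h <;> simp [h]

/-- The range of the coding map is closed. -/
theorem IsAttractor.isClosed_range {F : PadicIFS p} {K : Set ℚ_[p]} (h : F.IsAttractor K) :
    IsClosed (Set.range F.point) := by
  have h1 : Set.range F.point = (fun x : ℤ_[p] => (x : ℚ_[p])) ⁻¹' K := by
    rw [h.eq_range]
    exact (Set.preimage_image_eq _ fun x y e => PadicInt.ext e).symm
  rw [h1]
  exact h.2.1.isClosed.preimage continuous_subtype_val

theorem IsAttractor.range_point_compose_subset {F : PadicIFS p} {K : Set ℚ_[p]}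
    (h : F.IsAttractor K) {N : ℕ} (hN : 0 < N) (l : Fin N → List (Fin F.n))
    (hl : ∀ i, 1 ≤ F.kap (l i)) :
    Set.range (F.compose hN l hl).point ⊆ Set.range F.point := by
  rintro _ ⟨a, rfl⟩
  have h1 : ((F.compose hN l hl).point a : ℚ_[p]) ∈ K := by
    refine (F.compose hN l hl).point_mem_of_mapsTo h.1 h.2.1.isClosed (fun i x hx => ?_) a
    rw [h.eq_range] at hx ⊢
    obtain ⟨y, hy, rfl⟩ := hx
    refine ⟨_, F.comp_mem_range (l i) hy, ?_⟩
    dsimp only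
    rw [← F.mapInt_compose hN l hl i, coe_mapInt]
  rw [h.eq_range] at h1
  obtain ⟨y, hy, e⟩ := h1
  exact PadicInt.ext e ▸ hy

/-- For each prefix of length m one word of exponent at least m is kept. Its images lie in the class
of that prefix modulo p^m, so distinct words give separated images, and the subsystem's points
belong to K. -/
theorem IsAttractor.le_dimH {F : PadicIFS p} {K : Set ℚ_[p]} (h : F.IsAttractor K) {m : ℕ}
    (hm : 0 < m) : ENNReal.ofReal (Real.log (F.count m) / ((m + F.kSum : ℕ) * Real.log p)) ≤
      dimH (Set.range F.point) := by
  have hpos := F.count_pos m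
  -- A single prefix makes the bound 0; the Hölder argument needs at least two maps.
  rcases (Nat.succ_le_iff.2 hpos).eq_or_lt with h1 | h1
  · simp [← h1]
  have : Finite (prefixes m (Set.range F.point)) := finite_prefixes m _
  let e : prefixes m (Set.range F.point) ≃ Fin (F.count m) := Finite.equivFinOfCardEq rfl
  have hex : ∀ u : prefixes m (Set.range F.point), ∃ l : List (Fin F.n),
      m ≤ F.kap l ∧ F.kap l ≤ m + F.kSum ∧ ∃ z, (p : ℤ_[p]) ^ m ∣ F.comp l z - digitsVal u.1 := by
    rintro ⟨u, hu, hn⟩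
    obtain ⟨x, hx, hd⟩ := (residualSet_nonempty_iff u _).1 hn
    obtain ⟨l, z, -, e, h2, h3⟩ := F.exists_comp_eq hx m
    exact ⟨l, h2, h3, z, by rw [e]; exact hu ▸ hd⟩
  choose l h2 h3 z h4 using hex
  let G := F.compose hpos (fun i => l (e.symm i)) fun i => hm.trans_le (h2 _)
  have hsep : G.IsSeparated (m + F.kSum) := by
    intro i j hij x _ y _
    have hx := F.mapInt_compose hpos (fun i => l (e.symm i)) (fun i => hm.trans_le (h2 _)) i x
    have hy := F.mapInt_compose hpos (fun i => l (e.symm i)) (fun i => hm.trans_le (h2 _)) j y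
    change _ ≤ ‖(F.compose _ _ _).mapInt i x - (F.compose _ _ _).mapInt j y‖
    rw [hx, hy]
    refine (pow_le_pow_of_le_one inv_p_pos.le inv_p_lt_one.le (Nat.le_add_right m F.kSum)).trans ?_
    by_contra! hlt
    have h5 := (PadicInt.pow_p_dvd_iff_norm_le m _).2 hlt.le
    have h6 : ∀ (u : prefixes m (Set.range F.point)) (x : ℤ_[p]),
        (p : ℤ_[p]) ^ m ∣ F.comp (l u) x - digitsVal u.1 := fun u x => by
      have h7 : (p : ℤ_[p]) ^ m ∣ F.comp (l u) x - F.comp (l u) (z u) := by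
        rw [F.comp_eq, F.comp_eq _ (z u)]
        refine (pow_dvd_pow _ (h2 u)).trans ⟨(F.sgn (l u) : ℤ) * (x - z u), ?_⟩
        ring
      simpa using dvd_add h7 (h4 u)
    have h8 : (p : ℤ_[p]) ^ m ∣ F.comp (l (e.symm i)) x - digitsVal (e.symm j).1 := by
      simpa using dvd_add h5 (h6 (e.symm j) y)
    have h9 := natCast_eq_of_pow_dvd_sub
      ((digitsVal_lt _).trans_eq (by rw [(e.symm i).2.1]))
      ((digitsVal_lt _).trans_eq (by rw [(e.symm j).2.1])) (h6 (e.symm i) x) h8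
    refine hij (e.symm.injective (Subtype.ext (digitsVal_inj ?_ h9)))
    exact (e.symm i).2.1.trans (e.symm j).2.1.symm
  exact (hsep.le_dimH (fun i => h3 _) h1).trans
    (dimH_mono (h.range_point_compose_subset hpos _ _))

theorem mul_dimValue_le (F : PadicIFS p) (m : ℕ) :
    m * F.dimValue * Real.log p ≤ Real.log F.pieceCount + Real.log (F.count m) := by
  have h1 : (F.pieceCount : ℝ) ≠ 0 := by
    rw [pieceCount]; positivity
  have h2 : (F.count m : ℝ) ≠ 0 := by exact_mod_cast (F.count_pos m).ne'
  rw [← Real.log_mul h1 h2, dimValue, mul_assoc, div_mul_cancel₀ _ log_p_pos.ne', ← Real.log_pow]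
  have := F.one_le_spectralValue
  exact Real.log_le_log (by positivity) (F.spectralValue_pow_le m)

/-- Inserting λ^m ≤ C N_m into the lower bound gives log_p λ minus a term O(1/m). -/
theorem IsAttractor.dimH_range {F : PadicIFS p} {K : Set ℚ_[p]} (h : F.IsAttractor K) :
    dimH (Set.range F.point) = ENNReal.ofReal F.dimValue := by
  refine le_antisymm F.dimH_range_point_le ?_
  have hlp := log_p_pos (p := p)
  have hlim : Filter.Tendsto (fun m : ℕ => ENNReal.ofReal
      (((m + F.kSum : ℕ) * F.dimValue - (F.kSum * F.dimValue +
        Real.log F.pieceCount / Real.log p)) / (m + F.kSum : ℕ))) Filter.atTop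
      (nhds (ENNReal.ofReal F.dimValue)) := by
    refine ENNReal.tendsto_ofReal ?_
    have h1 : Filter.Tendsto (fun m : ℕ => F.dimValue - (F.kSum * F.dimValue +
        Real.log F.pieceCount / Real.log p) / (m + F.kSum : ℕ)) Filter.atTop
        (nhds (F.dimValue - 0)) := by
      refine tendsto_const_nhds.sub ?_
      exact (tendsto_const_div_atTop_nhds_zero_nat _).comp (Filter.tendsto_add_atTop_nat F.kSum)
    rw [sub_zero] at h1
    refine h1.congr' ?_
    filter_upwards [Filter.eventually_gt_atTop 0] with m hm
    have : ((m + F.kSum : ℕ) : ℝ) ≠ 0 := by positivity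
    rw [sub_div, mul_div_cancel_left₀ _ this]
  refine le_of_tendsto hlim ?_
  filter_upwards [Filter.eventually_gt_atTop 0] with m hm
  refine le_trans (ENNReal.ofReal_le_ofReal ?_) (h.le_dimH hm)
  have hpos : (0 : ℝ) < (m + F.kSum : ℕ) := by positivity
  rw [mul_comm ((m + F.kSum : ℕ) : ℝ) (Real.log p), ← div_div]
  refine div_le_div_of_nonneg_right ?_ hpos.le
  rw [le_div_iff₀ hlp, sub_mul, add_mul, div_mul_cancel₀ _ hlp.ne']
  have := F.mul_dimValue_le m
  push_cast
  linarith

theorem IsAttractor.dimH_eq {F : PadicIFS p} {K : Set ℚ_[p]} (h : F.IsAttractor K) :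
    dimH K = ENNReal.ofReal F.dimValue := by
  rw [← h.dimH_range, h.eq_range]
  exact Isometry.dimH_image (isometry_subtype_coe) _

theorem IsAttractor.log_count_le {F : PadicIFS p} {K : Set ℚ_[p]} (h : F.IsAttractor K) {m : ℕ}
    (hm : 0 < m) : Real.log (F.count m) ≤ (m + F.kSum) * F.dimValue * Real.log p := by
  have h1 := h.le_dimH hm
  rw [h.dimH_range, ENNReal.ofReal_le_ofReal_iff F.dimValue_nonneg,
    div_le_iff₀ (mul_pos (by positivity) log_p_pos)] at h1
  push_cast at h1
  linarith

end PadicIFS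

/-! ### The algorithm -/

/-- The encoding of a map `x ↦ (-1) ^ b * p ^ k * x + num / den` of the system. -/
abbrev MapCode : Type := Fin 2 × ℕ × ℤ × ℕ

namespace DimAlgorithm

open Encodable

/-- The product of the denominators. -/
def codeDen (l : List MapCode) : ℕ := l.foldr (fun t s => t.2.2.2 * s) 1

/-- The sum of the exponents. -/
def codeExp (l : List MapCode) : ℕ := l.foldr (fun t s => t.2.1 + s) 0

/-- The sum of the absolute values of the numerators. -/
def codeNum (l : List MapCode) : ℕ := l.foldr (fun t s => (encode t.2.2.1 + 1) / 2 + s) 0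

/-- The number of parameters of pieces. -/
def codePieces (p : ℕ) (l : List MapCode) : ℕ :=
  (2 * (codeDen l * codeNum l * p ^ codeExp l + codeDen l) + 1) * (2 * (codeExp l + 1))

/-- The constant in the error bound of the approximation of the dimension. -/
def codeConst (p : ℕ) (l : List MapCode) : ℕ := codeExp l + codePieces p l + 1

/-- The residue modulo `M` of the integer with code `e`. -/
def intMod (e M : ℕ) : ℕ := if e % 2 = 0 then e / 2 % M else M - 1 - e / 2 % M

/-- The action of a map modulo `M`, scaled by the common denominator `D`. -/
def step (p M D : ℕ) (t : MapCode) (x : ℕ) : ℕ :=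
  ((M - 1) ^ (t.1 : ℕ) * p ^ t.2.1 * x + intMod (encode t.2.2.1) M * (D / t.2.2.2)) % M

/-- The images of `0` modulo `M` under the compositions of `j` maps, scaled. -/
def images (p : ℕ) (l : List MapCode) (M j : ℕ) : List ℕ :=
  Nat.rec [0] (fun _ L => l.flatMap fun t => L.map fun x => step p M (codeDen l) t x) j

/-- The number of residues modulo `p ^ m` of points of the attractor. -/
def countResidues (p : ℕ) (l : List MapCode) (m : ℕ) : ℕ :=
  ((List.range (p ^ m)).filter fun r => ∃ a ∈ images p l (p ^ m) m, a = r).length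

/-- The precision used for the approximation of the dimension. -/
def precision (a : ℕ × List MapCode × ℕ) : ℕ := 2 * codeConst a.1 a.2.1 * (a.2.2 + 1)

/-- The integer part of the logarithm of the number of residues. -/
def logCount (a : ℕ × List MapCode × ℕ) : ℕ :=
  (precision a).findGreatest fun j => a.1 ^ j ≤ countResidues a.1 a.2.1 (precision a)

/-- The numerator of an approximation of the dimension with denominator `N + 1`. -/
def approxDim (a : ℕ × List MapCode × ℕ) : ℕ :=
  (logCount a + codeConst a.1 a.2.1) / (2 * codeConst a.1 a.2.1)

section Primrec

open Primrec

theorem primrec_pow : Primrec₂ ((· ^ ·) : ℕ → ℕ → ℕ) := Primrec₂.unpaired'.1 Nat.Primrec.pow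

theorem primrec_codeDen : Primrec codeDen :=
  list_foldr (h := fun _ (t : MapCode × ℕ) => t.1.2.2.2 * t.2) .id (const 1)
    (nat_mul.comp (snd.comp (snd.comp (snd.comp (fst.comp snd)))) (snd.comp snd)).to₂

theorem primrec_codeExp : Primrec codeExp :=
  list_foldr (h := fun _ (t : MapCode × ℕ) => t.1.2.1 + t.2) .id (const 0)
    (nat_add.comp (fst.comp (snd.comp (fst.comp snd))) (snd.comp snd)).to₂

theorem primrec_codeNum : Primrec codeNum :=
  list_foldr (h := fun _ (t : MapCode × ℕ) => (encode t.1.2.2.1 + 1) / 2 + t.2) .id (const 0)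
    (nat_add.comp (nat_div.comp (nat_add.comp
      (Primrec.encode.comp (fst.comp (snd.comp (snd.comp (fst.comp snd))))) (const 1)) (const 2))
      (snd.comp snd)).to₂

theorem primrec_codePieces : Primrec₂ codePieces := by
  have hD := primrec_codeDen.comp (snd (α := ℕ))
  have hE := primrec_codeExp.comp (snd (α := ℕ))
  have hN := primrec_codeNum.comp (snd (α := ℕ))
  exact (nat_mul.comp (nat_add.comp (nat_mul.comp (const 2) (nat_add.comp (nat_mul.comp
    (nat_mul.comp hD hN) (primrec_pow.comp fst hE)) hD)) (const 1))
    (nat_mul.comp (const 2) (nat_add.comp hE (const 1)))).to₂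

theorem primrec_codeConst : Primrec₂ codeConst :=
  (nat_add.comp (nat_add.comp (primrec_codeExp.comp snd) (primrec_codePieces.comp fst snd))
    (const 1)).to₂

theorem primrec_intMod : Primrec₂ intMod :=
  (Primrec.ite (Primrec.eq.comp (nat_mod.comp fst (const 2)) (const 0))
    (nat_mod.comp (nat_div.comp fst (const 2)) snd)
    (nat_sub.comp (nat_sub.comp snd (const 1)) (nat_mod.comp (nat_div.comp fst (const 2)) snd))).to₂

theorem primrec_step {α : Type} [Primcodable α] {p M D x : α → ℕ} {t : α → MapCode}
    (hp : Primrec p) (hM : Primrec M) (hD : Primrec D) (ht : Primrec t) (hx : Primrec x) :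
    Primrec fun a => step (p a) (M a) (D a) (t a) (x a) :=
  nat_mod.comp (nat_add.comp
    (nat_mul.comp (nat_mul.comp (primrec_pow.comp (nat_sub.comp hM (const 1))
      (fin_val.comp (fst.comp ht))) (primrec_pow.comp hp (fst.comp (snd.comp ht)))) hx)
    (nat_mul.comp (primrec_intMod.comp (Primrec.encode.comp (fst.comp (snd.comp (snd.comp ht)))) hM)
      (nat_div.comp hD (snd.comp (snd.comp (snd.comp ht)))))) hM

theorem primrec_images {α : Type} [Primcodable α] {p M j : α → ℕ} {l : α → List MapCode}
    (hp : Primrec p) (hl : Primrec l) (hM : Primrec M) (hj : Primrec j) :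
    Primrec fun a => images (p a) (l a) (M a) (j a) := by
  have h1 : Primrec fun y : ((α × ℕ × List ℕ) × MapCode) × ℕ =>
      step (p y.1.1.1) (M y.1.1.1) (codeDen (l y.1.1.1)) y.1.2 y.2 := by
    have ha := (fst (α := α) (β := ℕ × List ℕ)).comp
      ((fst (β := MapCode)).comp (fst (β := ℕ)))
    exact primrec_step (hp.comp ha) (hM.comp ha) (primrec_codeDen.comp (hl.comp ha))
      (snd.comp fst) snd
  have h2 : Primrec fun y : (α × ℕ × List ℕ) × MapCode =>
      y.1.2.2.map fun x => step (p y.1.1) (M y.1.1) (codeDen (l y.1.1)) y.2 x :=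
    list_map (snd.comp (snd.comp fst)) h1.to₂
  have h3 : Primrec fun y : α × ℕ × List ℕ => (l y.1).flatMap fun t =>
      y.2.2.map fun x => step (p y.1) (M y.1) (codeDen (l y.1)) t x :=
    list_flatMap (hl.comp fst) h2.to₂
  exact nat_rec' (h := fun a t => (l a).flatMap fun s =>
    t.2.map fun x => step (p a) (M a) (codeDen (l a)) s x) hj (const [0]) h3.to₂

theorem primrec_countResidues {α : Type} [Primcodable α] {p m : α → ℕ} {l : α → List MapCode}
    (hp : Primrec p) (hl : Primrec l) (hm : Primrec m) :
    Primrec fun a => countResidues (p a) (l a) (m a) := by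
  have h1 : PrimrecRel fun (r : ℕ) (L : List ℕ) => ∃ a ∈ L, a = r :=
    (PrimrecRel.exists_mem_list (R := fun a b : ℕ => a = b) Primrec.eq).comp snd fst
  have hq := primrec_pow.comp hp hm
  exact list_length.comp (h1.listFilter.comp (list_range.comp hq) (primrec_images hp hl hq hm))

theorem primrec_precision : Primrec precision :=
  nat_mul.comp (nat_mul.comp (const 2) (primrec_codeConst.comp fst (fst.comp snd)))
    (nat_add.comp (snd.comp snd) (const 1))

theorem primrec_logCount : Primrec logCount := by
  refine nat_findGreatest primrec_precision ?_
  exact nat_le.comp (primrec_pow.comp (fst.comp fst) snd)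
    ((primrec_countResidues fst (fst.comp snd) primrec_precision).comp fst)

theorem primrec_approxDim : Primrec approxDim := by
  have hc : Primrec fun a : ℕ × List MapCode × ℕ => codeConst a.1 a.2.1 :=
    primrec_codeConst.comp fst (fst.comp snd)
  exact nat_div.comp (nat_add.comp primrec_logCount hc) (nat_mul.comp (const 2) hc)

end Primrec

/-- Integers are encoded by n ↦ 2n and -(n+1) ↦ 2n+1, so parity gives the sign and halving gives n.
-/
theorem intMod_cast {M : ℕ} (hM : 0 < M) (z : ℤ) :
    ((intMod (encode z) M : ℕ) : ZMod M) = z := by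
  rcases z with n | n
  · have e : encode (Int.ofNat n) = 2 * n := rfl
    rw [e, intMod, if_pos (by omega), Nat.mul_div_cancel_left _ two_pos]
    simp
  · have e : encode (Int.negSucc n) = 2 * n + 1 := rfl
    have h1 : (2 * n + 1) / 2 = n := by omega
    have h2 := Nat.mod_lt n hM
    rw [e, intMod, if_neg (by omega), h1, Nat.cast_sub (by omega), Nat.cast_sub (by omega),
      Int.cast_negSucc]
    simp
    ring

theorem natAbs_eq_encode (z : ℤ) : z.natAbs = (encode z + 1) / 2 := by
  rcases z with n | n
  · have e : encode (Int.ofNat n) = 2 * n := rfl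
    rw [e, Int.ofNat_eq_natCast, Int.natAbs_natCast]
    omega
  · have e : encode (Int.negSucc n) = 2 * n + 1 := rfl
    rw [e, Int.natAbs_negSucc]
    omega

variable {p : ℕ} [Fact p.Prime]

theorem codeDen_code (F : PadicIFS p) : codeDen F.code = F.den := by
  have : ∀ l : List MapCode, codeDen l = (l.map fun t => t.2.2.2).prod := fun l => by
    induction l with
    | nil => rfl
    | cons t l ih => rw [List.map_cons, List.prod_cons, ← ih]; rfl
  rw [this, PadicIFS.code, List.map_ofFn, List.prod_ofFn]
  rfl

theorem codeExp_code (F : PadicIFS p) : codeExp F.code = F.kSum := by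
  have : ∀ l : List MapCode, codeExp l = (l.map fun t => t.2.1).sum := fun l => by
    induction l with
    | nil => rfl
    | cons t l ih => rw [List.map_cons, List.sum_cons, ← ih]; rfl
  rw [this, PadicIFS.code, List.map_ofFn, List.sum_ofFn]
  rfl

theorem codeNum_code (F : PadicIFS p) : codeNum F.code = ∑ i, (F.d i).num.natAbs := by
  have : ∀ l : List MapCode, codeNum l = (l.map fun t => t.2.2.1.natAbs).sum := fun l => by
    induction l with
    | nil => rfl
    | cons t l ih => rw [List.map_cons, List.sum_cons, ← ih, natAbs_eq_encode]; rfl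
  rw [this, PadicIFS.code, List.map_ofFn, List.sum_ofFn]
  rfl

theorem codePieces_code (F : PadicIFS p) : codePieces p F.code = F.pieceCount := by
  rw [codePieces, codeDen_code, codeExp_code, codeNum_code]
  rfl

theorem images_succ (p : ℕ) (l : List MapCode) (M j : ℕ) : images p l M (j + 1) =
    l.flatMap fun t => (images p l M j).map fun x => step p M (codeDen l) t x := rfl

theorem mem_images_succ (F : PadicIFS p) (M j x : ℕ) : x ∈ images p F.code M (j + 1) ↔
    ∃ i, ∃ y ∈ images p F.code M j,
      step p M F.den (F.b i, F.k i, (F.d i).num, (F.d i).den) y = x := by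
  simp [images_succ, PadicIFS.code, List.mem_flatMap, List.mem_ofFn, ← codeDen_code]

theorem images_lt {F : PadicIFS p} {M : ℕ} (hM : 0 < M) {j x : ℕ}
    (hx : x ∈ images p F.code M j) : x < M := by
  cases j with
  | zero =>
    rw [List.mem_singleton.1 hx]
    exact hM
  | succ j =>
    obtain ⟨i, y, -, rfl⟩ := (mem_images_succ F M j x).1 hx
    exact Nat.mod_lt _ hM

/-- The natural number M - 1 plays the role of -1 modulo M. -/
theorem step_cast (F : PadicIFS p) {M : ℕ} (hM : 0 < M) (i : Fin F.n) (y : ℕ) :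
    ((step p M F.den (F.b i, F.k i, (F.d i).num, (F.d i).den) y : ℕ) : ZMod M) =
      (-1) ^ (F.b i : ℕ) * (p : ZMod M) ^ F.k i * y + F.num i := by
  rw [step, ZMod.natCast_mod]
  rw [PadicIFS.num, Nat.cast_add, Nat.cast_mul, Nat.cast_mul, Nat.cast_mul, intMod_cast hM,
    Nat.cast_pow, Nat.cast_pow, Nat.cast_sub (Nat.succ_le_iff.2 hM),
    Int.cast_mul, Int.cast_natCast]
  simp

theorem cast_images (F : PadicIFS p) {M : ℕ} (hM : 0 < M) (j : ℕ) :
    (fun x : ℕ => (x : ZMod M)) '' {x | x ∈ images p F.code M j} =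
      (fun l => (F.numComp l : ZMod M)) '' {l | l.length = j} := by
  induction j with
  | zero =>
    ext z
    simp [images, PadicIFS.numComp, List.length_eq_zero_iff]
  | succ j ih =>
    ext z
    constructor
    · rintro ⟨x, hx, rfl⟩
      obtain ⟨i, y, hy, rfl⟩ := (mem_images_succ F M j x).1 hx
      obtain ⟨l, hl, e⟩ := ih.subset ⟨y, hy, rfl⟩
      refine ⟨i :: l, by simpa using hl, ?_⟩
      dsimp only at e ⊢
      rw [step_cast F hM, ← e]
      simp [PadicIFS.numComp]
    · rintro ⟨l, hl, rfl⟩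
      obtain ⟨i, l, rfl⟩ := List.exists_cons_of_length_eq_add_one hl
      obtain ⟨y, hy, e⟩ := ih.superset ⟨l, by simpa using hl, rfl⟩
      refine ⟨_, (mem_images_succ F M j _).2 ⟨i, y, hy, rfl⟩, ?_⟩
      dsimp only at e ⊢
      rw [step_cast F hM, e]
      simp [PadicIFS.numComp]

/-- A word of length m has exponent at least m, so its composition is constant modulo p^m; starting
from 0 reaches the same residues as starting from K. -/
theorem numComp_image_eq (F : PadicIFS p) (m : ℕ) :
    (fun l => (F.numComp l : ZMod (p ^ m))) '' {l | l.length = m} =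
      (fun z => (F.den : ZMod (p ^ m)) * z) ''
        (PadicInt.toZModPow m '' Set.range F.point) := by
  have key : ∀ l : List (Fin F.n), l.length = m → ∀ z : ℤ_[p],
      (F.den : ZMod (p ^ m)) * PadicInt.toZModPow m (F.comp l z) = F.numComp l := by
    intro l hl z
    have h1 : (p : ℤ_[p]) ^ m ∣ F.den * F.comp l z - F.numComp l := by
      rw [← F.den_mul_comp, ← mul_sub, F.comp_eq l z, add_sub_cancel_right]
      have h2 : (p : ℤ_[p]) ^ m ∣ (p : ℤ_[p]) ^ F.kap l :=
        pow_dvd_pow _ (hl ▸ F.length_le_kap l)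
      exact ((h2.mul_left _).mul_right _).mul_left _
    have := (toZModPow_eq_iff m _ _).2 h1
    simpa using this
  ext z
  constructor
  · rintro ⟨l, hl, rfl⟩
    obtain ⟨x, hx⟩ := F.range_point_nonempty
    exact ⟨_, ⟨_, F.comp_mem_range l hx, rfl⟩, key l hl x⟩
  · rintro ⟨_, ⟨_, ⟨a, rfl⟩, rfl⟩, rfl⟩
    refine ⟨(List.range m).map a, by simp, ?_⟩
    rw [F.point_eq_comp a m]
    exact (key _ (by simp) _).symm

/-- The computed list contains the residues of D·K, and multiplication by D permutes the residues
modulo p^m. -/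
theorem countResidues_eq (F : PadicIFS p) (m : ℕ) :
    countResidues p F.code m = F.count m := by
  have hM : 0 < p ^ m := pow_pos (Fact.out : p.Prime).pos m
  have h1 : {x | x ∈ images p F.code (p ^ m) m}.ncard = F.count m := by
    rw [PadicIFS.count, PadicIFS.initState, prefixCount_eq_ncard,
      ← Set.ncard_image_of_injective (PadicInt.toZModPow m '' Set.range F.point)
        (f := fun z => (F.den : ZMod (p ^ m)) * z), ← numComp_image_eq, ← cast_images F hM,
      Set.InjOn.ncard_image]
    · intro x hx y hy e
      exact Nat.ModEq.eq_of_lt_of_lt ((ZMod.natCast_eq_natCast_iff _ _ _).1 e)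
        (images_lt hM hx) (images_lt hM hy)
    · have hu : IsUnit (F.den : ZMod (p ^ m)) :=
        (ZMod.isUnit_iff_coprime _ _).2 (F.coprime_den m).symm
      exact hu.mul_right_injective
  rw [← h1, countResidues, ← List.toFinset_card_of_nodup (List.nodup_range.filter _),
    ← Set.ncard_coe_finset]
  congr 1
  ext x
  simp only [exists_eq_right, List.coe_toFinset, List.mem_filter, List.mem_range,
    decide_eq_true_eq, Set.mem_ofPred_eq, and_iff_right_iff_imp]
  exact fun hx => images_lt hM hx

/-- With m = 2c(N+1), the integer part L of log_p N_m is within c of m dim K. Rounding L/(2c) to f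
costs at most another c on the scale of L, so |m dim K - 2cf| ≤ 2c; divide by m. -/
theorem abs_dimValue_sub_le {F : PadicIFS p} {K : Set ℚ_[p]} (h : F.IsAttractor K) (N : ℕ) :
    |F.dimValue - (approxDim (p, F.code, N) : ℝ) / (N + 1)| ≤ 1 / (N + 1) := by
  set c := codeConst p F.code with hc
  have hc' : c = F.kSum + F.pieceCount + 1 := by
    rw [hc, codeConst, codeExp_code, codePieces_code]
  set m := precision (p, F.code, N) with hm
  have hm' : m = 2 * c * (N + 1) := rfl
  set L := logCount (p, F.code, N) with hL
  have hL' : L = m.findGreatest fun j => p ^ j ≤ F.count m := by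
    rw [hL, logCount]
    simp only [← hm, countResidues_eq]
  have hp1 := PadicIFS.one_lt_p (p := p)
  have hlp := PadicIFS.log_p_pos (p := p)
  have hc0 : 0 < c := by omega
  have hm0 : 0 < m := by rw [hm']; positivity
  have hN0 := F.count_pos m
  have hNm : F.count m ≤ p ^ m := prefixCount_le_pow m _
  have hL1 : p ^ L ≤ F.count m := by
    rw [hL']
    exact Nat.findGreatest_spec (P := fun j => p ^ j ≤ F.count m) (Nat.zero_le m)
      (by rw [pow_zero]; exact hN0)
  have hL2 : F.count m ≤ p ^ (L + 1) := by
    -- The search for L stops at m; if it ends there, N_m ≤ p^m gives the upper bound.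
    by_cases hle : L + 1 ≤ m
    · have := Nat.findGreatest_is_greatest (P := fun j => p ^ j ≤ F.count m) (k := L + 1)
        (by rw [← hL']; omega) hle
      exact (not_le.1 this).le
    · exact hNm.trans (Nat.pow_le_pow_right hp1.le (by omega))
  have hlogpow : ∀ j : ℕ, Real.log ((p ^ j : ℕ) : ℝ) = j * Real.log p := fun j => by
    rw [Nat.cast_pow, Real.log_pow]
  have hmono : ∀ {a b : ℕ}, 0 < a → a ≤ b → Real.log a ≤ Real.log b := fun ha hab =>
    Real.log_le_log (by exact_mod_cast ha) (by exact_mod_cast hab)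
  obtain ⟨x, hx⟩ : ∃ x, Real.log (F.count m) = x * Real.log p :=
    ⟨_, (div_mul_cancel₀ _ hlp.ne').symm⟩
  have hx1 : (L : ℝ) ≤ x := by
    have := hmono (by positivity) hL1
    rw [hlogpow, hx] at this
    exact le_of_mul_le_mul_right this hlp
  have hx2 : x ≤ L + 1 := by
    have := hmono hN0 hL2
    rw [hlogpow, hx] at this
    exact_mod_cast le_of_mul_le_mul_right this hlp
  have hx3 : x ≤ m := by
    have := hmono hN0 hNm
    rw [hlogpow, hx] at this
    exact le_of_mul_le_mul_right this hlp
  have hx4 : x ≤ (m + F.kSum) * F.dimValue := by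
    have := h.log_count_le hm0
    rw [hx] at this
    exact le_of_mul_le_mul_right this hlp
  have hx5 : m * F.dimValue ≤ F.pieceCount + x := by
    have h1 := F.mul_dimValue_le m
    -- C < p^C replaces log_p C by the integer C, so that the error constant is computable without
    -- logarithms.
    have h2 := hmono (by rw [PadicIFS.pieceCount]; positivity)
      (Nat.lt_pow_self hp1 (n := F.pieceCount)).le
    rw [hlogpow] at h2
    rw [hx] at h1
    refine le_of_mul_le_mul_right ?_ hlp
    linarith
  have hd0 := F.dimValue_nonneg
  have hk0 : (0 : ℝ) ≤ F.kSum := by positivity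
  have hx6 : x - F.kSum ≤ m * F.dimValue := by
    -- If the dimension is at most 1, the surplus Σk_i · dim is at most Σk_i; otherwise x ≤ m ≤ m
    -- dim already suffices.
    rcases le_total F.dimValue 1 with hd | hd
    · nlinarith [mul_le_mul_of_nonneg_left hd hk0]
    · nlinarith [mul_le_mul_of_nonneg_left hd (Nat.cast_nonneg (α := ℝ) m)]
  have hcR : (c : ℝ) = F.kSum + F.pieceCount + 1 := by rw [hc']; push_cast; ring
  have hmR : (m : ℝ) = 2 * c * (N + 1) := by rw [hm']; push_cast; ring
  have hcpos : (0 : ℝ) < c := by exact_mod_cast hc0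
  have hf : approxDim (p, F.code, N) = (L + c) / (2 * c) := rfl
  set f := approxDim (p, F.code, N)
  have hf1 : (f : ℝ) * (2 * c) ≤ L + c := by
    have := Nat.div_mul_le_self (L + c) (2 * c)
    rw [← hf] at this
    exact_mod_cast this
  have hf2 : (L + c : ℝ) ≤ (f + 1) * (2 * c) := by
    have := (Nat.lt_mul_div_succ (L + c) (by omega : 0 < 2 * c)).le
    rw [← hf, mul_comm] at this
    exact_mod_cast this
  have hNp : (0 : ℝ) < N + 1 := by positivity
  have hpc0 : (0 : ℝ) ≤ F.pieceCount := by positivity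
  have hdist : |(N + 1) * F.dimValue - f| ≤ 1 := by
    rw [hmR] at hx5 hx6
    rw [abs_le]
    constructor
    · refine le_of_mul_le_mul_left ?_ (by positivity : (0 : ℝ) < 2 * c)
      linarith
    · refine le_of_mul_le_mul_left ?_ (by positivity : (0 : ℝ) < 2 * c)
      linarith
  have e : F.dimValue - (f : ℝ) / (N + 1) = ((N + 1) * F.dimValue - f) / (N + 1) := by
    field_simp
  rw [e, abs_div, abs_of_pos hNp]
  gcongr

end DimAlgorithm

/-! ### Recognition of the expansions and conclusion -/

namespace PadicIFS

variable {p : ℕ} [Fact p.Prime]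

theorem IsAttractor.mem_infiniteWords_iff {F : PadicIFS p} {K : Set ℚ_[p]} (h : F.IsAttractor K)
    (w : ℕ → Fin p) : w ∈ F.automaton.infiniteWords ↔ (wordVal w : ℚ_[p]) ∈ K := by
  rw [F.mem_infiniteWords_automaton h.isClosed_range, h.eq_range]
  exact ⟨fun hw => ⟨_, hw, rfl⟩, fun ⟨y, hy, e⟩ => PadicInt.ext e ▸ hy⟩

theorem IsAttractor.infiniteWords_automaton {F : PadicIFS p} {K : Set ℚ_[p]}
    (h : F.IsAttractor K) : F.automaton.infiniteWords = expansionLanguage p K := by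
  ext w
  rw [h.mem_infiniteWords_iff]
  simp [expansionLanguage, isPadicExpansion_iff_eq]

theorem IsAttractor.isPathSetFractal {F : PadicIFS p} {K : Set ℚ_[p]} (h : F.IsAttractor K) :
    IsPathSetFractal p K := by
  refine ⟨F.State, inferInstance, F.automaton, F.automaton_isPathAutomaton, ?_⟩
  ext x
  simp only [Set.mem_ofPred_eq, h.mem_infiniteWords_iff, isPadicExpansion_iff_eq]
  constructor
  · intro hx
    have hx' := hx
    rw [h.eq_range] at hx'
    obtain ⟨y, -, rfl⟩ := hx'
    obtain ⟨w, rfl⟩ := exists_wordVal_eq y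
    exact ⟨w, hx, rfl⟩
  · rintro ⟨w, hw, rfl⟩
    exact hw

end PadicIFS

theorem theorem3p2 :
    (∀ (p : ℕ) [Fact p.Prime] (F : PadicIFS p) (K : Set ℚ_[p]), F.IsAttractor K →
      -- the points of `K` are the address sums
      (∀ x, x ∈ K ↔ ∃ a, F.IsAddressSum a x) ∧
      -- a finite transducer, with states (carry, sign), rewrites address sums into expansions
      (∃ (S : Finset (ℚ × ℤˣ)) (T : Transducer (Fin F.n) (Fin p) S),
        T.init.1 = (0, 1) ∧
        (∀ q ∈ S, ‖(q.1 : ℚ_[p])‖ ≤ 1) ∧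
        T.IsSequential ∧
        (∀ (q : S) (i : Fin F.n) (q' : S) (u : List (Fin p)), (q, i, q', u) ∈ T.trans →
          u.length = F.k i ∧
          q.1.1 + ((q.1.2 : ℤ) : ℚ) * F.d i =
            (Nat.ofDigits p (u.map Fin.val) : ℚ) + (p : ℚ) ^ F.k i * q'.1.1 ∧
          q'.1.2 = (-1) ^ (F.b i : ℕ) * q.1.2) ∧
        (∀ (a : ℕ → Fin F.n) (w : ℕ → Fin p),
          T.Writes a w ↔ ∃ x, F.IsAddressSum a x ∧ IsPadicExpansion p w x)) ∧
      -- a deterministic finite automaton recognizes the expansions and gives the dimension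
      (∃ (σ : Type) (_ : Fintype σ) (_ : DecidableEq σ) (M : NFA (Fin p) σ),
        M.IsPathAutomaton ∧ M.IsDeterministic ∧
        M.infiniteWords = expansionLanguage p K ∧
        dimH K = ENNReal.ofReal
          (Real.log (spectralRadius ℂ M.adjacency).toReal / Real.log p)) ∧
      IsPathSetFractal p K) ∧
    -- one algorithm computes the dimension to any precision from `p` and the system
    (∃ f : ℕ × List (Fin 2 × ℕ × ℤ × ℕ) × ℕ → ℕ, Computable f ∧
      ∀ (p : ℕ) [Fact p.Prime] (F : PadicIFS p) (K : Set ℚ_[p]), F.IsAttractor K →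
        ∀ N : ℕ, |(dimH K).toReal - (f (p, F.code, N) : ℝ) / (N + 1)| ≤ 1 / (N + 1)) := by

  refine ⟨fun p _ F K h => ⟨h.mem_iff, ?_, ?_, ?_⟩, DimAlgorithm.approxDim,
    DimAlgorithm.primrec_approxDim.to_comp, fun p _ F K h N => ?_⟩
  · refine ⟨F.states, F.transducer, rfl, fun q hq => F.norm_le_one_of_mem_states hq,
      F.transducer_isSequential, fun q i q' u hu => ?_, F.transducer_writes_iff⟩
    obtain ⟨h1, h2, h3⟩ := (F.mem_trans q i q' u).1 hu
    refine ⟨h1, ?_, h3⟩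
    rw [h2, digitsVal, Nat.coe_ofDigits]
  · exact ⟨F.State, inferInstance, inferInstance, F.automaton, F.automaton_isPathAutomaton,
      F.automaton_isDeterministic, h.infiniteWords_automaton, h.dimH_eq⟩
  · exact h.isPathSetFractal
  · rw [h.dimH_eq, ENNReal.toReal_ofReal F.dimValue_nonneg]
    exact DimAlgorithm.abs_dimValue_sub_le h N
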